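/- Let $U\subseteq\mathbb C$ be open and let $F:U\to\mathbb R$ be a smooth function with $F_{z\bar z}>0$. Let $M=\{(z,u+\mathrm i v)\in\mathbb C^2 : z\in U,\ v=F(z,\bar z)\}$ be the Sasakian $3$-manifold with potential $F$; in the coordinates $(z,u)$, $z=x+\mathrm iy$, its contact form is $\lambda'=du-\mathrm iF_z\,dz+\mathrm iF_{\bar z}\,d\bar z$, and its CR structure is given by the forms $\mu=dz$ and $\lambda=\lambda'/(2F_{z\bar z})$. Suppose that the underlying Kähler metric $h=2F_{z\bar z}\,dz\,d\bar z=2F_{z\bar z}(dx^2+dy^2)$ on $U$ is Einstein with constant $\Lambda_o\neq 0$, $\operatorname{Ric}(h)=\Lambda_o h$, and let $\Lambda\neq 0$ be a real constant of the same sign as $\Lambda_o$. Let $q$ be either of the constants $\pm\sqrt{3\Lambda_o/(4\Lambda)}$. Then $q$ is a solution on $U$ of the logistic equation $$q_{z\bar z}-\tfrac14\big(\partial_z\partial_{\bar z}\log F_{z\bar z}\big)\,q=\tfrac{\Lambda}{3}F_{z\bar z}\,q^3 ,$$ and on the $4$-manifold $\mathscr M=\{(z,u,r): z\in U,\ u,r\in\mathbb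 R,\ \cos\frac r2\neq 0\}$ there exist a smooth complex function $\mathscr W$ and a smooth real function $\mathscr H$ such that, with $$\mathscr P=\frac{q\sqrt{F_{z\bar z}}}{\cos(r/2)},$$ the metric $$g=2\mathscr P^2\big(\mu\bar\mu+\lambda(dr+\mathscr W\mu+\overline{\mathscr W}\bar\mu+\mathscr H\lambda)\big)$$ (products of $1$-forms being symmetric products $\omega\gamma=\frac12(\omega\otimes\gamma+\gamma\otimes\omega)$) has the following properties: $g$ is a smooth Lorentzian metric; the vector field $k=\partial_r$ is shearfree for $g$, i.e. it is nowhere zero, $g(k,k)=0$, and $\mathcal L_k g=\rho g+\theta\psi$ with $\theta=g(k,\cdot)$, a smooth real function $\rho$ and a smooth $1$-form $\psi$; $g$ is Einstein, $\operatorname{Ric}(g)=\Lambda g$; in particular $\operatorname{Ric}_{33}=\operatorname{Ric}(e_3,e_3)=0$ for $e_3=\frac1{\mathscr P}(2F_{z\bar z}\,\partial_u-\mathscr H\,\partial_r)$; and at every point $g$ is of Petrov type II or D. -/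

import Mathlib

open scoped ContDiff Matrix

noncomputable section

namespace ShearfreeLift

/-! ### Wirtinger derivatives -/

/-- `∂f/∂z = (f_x - i f_y) / 2`. -/
def dZ (f : ℂ → ℂ) (z : ℂ) : ℂ :=
  (fderiv ℝ f z 1 - Complex.I * fderiv ℝ f z Complex.I) / 2

/-- `∂f/∂z̄ = (f_x + i f_y) / 2`. -/
def dZbar (f : ℂ → ℂ) (z : ℂ) : ℂ :=
  (fderiv ℝ f z 1 + Complex.I * fderiv ℝ f z Complex.I) / 2

/-- The mixed derivative `F_{z z̄}` of a real function; for a `C²` function the complex number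
`∂_z ∂_z̄ F` is real, so that nothing is lost by taking its real part. -/
def mixed (F : ℂ → ℝ) (z : ℂ) : ℝ :=
  (dZ (dZbar fun w => (F w : ℂ)) z).re

/-! ### Pseudo-Riemannian geometry in coordinates -/

/-- The partial derivative of `f` in the `i`-th coordinate. -/
def pd {n : ℕ} {E : Type*} [NormedAddCommGroup E] [NormedSpace ℝ E]
    (i : Fin n) (f : (Fin n → ℝ) → E) (p : Fin n → ℝ) : E :=
  fderiv ℝ f p (Pi.single i 1)

/-- A field of bilinear forms on (a part of) `ℝⁿ`, by its matrix in the standard coordinates. -/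
abbrev Tensor2 (n : ℕ) := (Fin n → ℝ) → Matrix (Fin n) (Fin n) ℝ

/-- Christoffel symbols `Γ^i_{jk}` of the Levi-Civita connection. -/
def christoffel {n : ℕ} (g : Tensor2 n) (i j k : Fin n) (p : Fin n → ℝ) : ℝ :=
  (1 / 2) * ∑ l, (g p)⁻¹ i l *
    (pd j (fun x => g x l k) p + pd k (fun x => g x j l) p - pd l (fun x => g x j k) p)

/-- The Riemann tensor
`R^i_{jkl} = ∂_k Γ^i_{lj} - ∂_l Γ^i_{kj} + Γ^i_{km} Γ^m_{lj} - Γ^i_{lm} Γ^m_{kj}`. -/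
def riemann {n : ℕ} (g : Tensor2 n) (i j k l : Fin n) (p : Fin n → ℝ) : ℝ :=
  pd k (christoffel g i l j) p - pd l (christoffel g i k j) p
    + ∑ m, (christoffel g i k m p * christoffel g m l j p
      - christoffel g i l m p * christoffel g m k j p)

/-- The Ricci tensor `Ric_{jl} = R^i_{jil}`. -/
def ricci {n : ℕ} (g : Tensor2 n) : Tensor2 n :=
  fun p => Matrix.of fun j l => ∑ i, riemann g i j i l p

/-- The scalar curvature. -/
def scalarCurvature {n : ℕ} (g : Tensor2 n) (p : Fin n → ℝ) : ℝ :=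
  ∑ j, ∑ l, (g p)⁻¹ j l * ricci g p j l

/-- The Einstein condition `Ric(g) = c g` on `S`. -/
def IsEinsteinOn {n : ℕ} (g : Tensor2 n) (S : Set (Fin n → ℝ)) (c : ℝ) : Prop :=
  ∀ p ∈ S, ricci g p = c • g p

/-- The Weyl tensor `C_{ijkl}` of a metric in dimension four. -/
def weyl (g : Tensor2 4) (i j k l : Fin 4) (p : Fin 4 → ℝ) : ℝ :=
  (∑ m, g p i m * riemann g m j k l p)
    - (1 / 2) * (g p i k * ricci g p j l - g p i l * ricci g p j k
        - g p j k * ricci g p i l + g p j l * ricci g p i k)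
    + (scalarCurvature g p / 6) * (g p i k * g p j l - g p i l * g p j k)

/-- `g` is a smooth Lorentzian metric, of signature `(+,+,+,-)`, on `S`. -/
def IsLorentzianOn (g : Tensor2 4) (S : Set (Fin 4 → ℝ)) : Prop :=
  (∀ i j, ContDiffOn ℝ ∞ (fun p => g p i j) S) ∧
  ∀ p ∈ S, (g p).IsSymm ∧
    ∃ A : Matrix (Fin 4) (Fin 4) ℝ, Aᵀ * g p * A = Matrix.diagonal ![1, 1, 1, -1]

/-- The symmetric product `α β = (α ⊗ β + β ⊗ α) / 2` of two covectors. -/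
def symProd {n : ℕ} (α β : Fin n → ℝ) : Matrix (Fin n) (Fin n) ℝ :=
  Matrix.of fun i j => (α i * β j + β i * α j) / 2

/-- The Lie derivative `(L_k g)_{ij}`. -/
def lieDerivMetric {n : ℕ} (k : (Fin n → ℝ) → Fin n → ℝ) (g : Tensor2 n) : Tensor2 n :=
  fun p => Matrix.of fun i j => ∑ l, (k p l * pd l (fun x => g x i j) p
    + g p l j * pd i (fun x => k x l) p + g p i l * pd j (fun x => k x l) p)

/-- The vector field `k` is shearfree for `g` on `S`: it is smooth, nowhere zero, null, and
`L_k g = ρ g + θ ψ` with `θ = g(k, ·)`, a real function `ρ` and a 1-form `ψ`. -/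
def IsShearfreeOn (g : Tensor2 4) (S : Set (Fin 4 → ℝ)) (k : (Fin 4 → ℝ) → Fin 4 → ℝ) : Prop :=
  ContDiffOn ℝ ∞ k S ∧
  (∀ p ∈ S, k p ≠ 0 ∧ k p ⬝ᵥ (g p *ᵥ k p) = 0) ∧
  ∃ (ρ : (Fin 4 → ℝ) → ℝ) (ψ : (Fin 4 → ℝ) → Fin 4 → ℝ),
    ContDiffOn ℝ ∞ ρ S ∧ ContDiffOn ℝ ∞ ψ S ∧
    ∀ p ∈ S, lieDerivMetric k g p = ρ p • g p + symProd (g p *ᵥ k p) (ψ p)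

/-! ### Petrov types -/

/-- The complex bilinear extension of `g`. -/
def metricC (g : Tensor2 4) (p : Fin 4 → ℝ) (a b : Fin 4 → ℂ) : ℂ :=
  ∑ i, ∑ j, (g p i j : ℂ) * a i * b j

/-- The complex multilinear extension of the Weyl tensor. -/
def weylC (g : Tensor2 4) (p : Fin 4 → ℝ) (a b c d : Fin 4 → ℂ) : ℂ :=
  ∑ i, ∑ j, ∑ k, ∑ l, (weyl g i j k l p : ℂ) * a i * b j * c k * d l

/-- A real vector regarded as a complex one. -/
def toC (v : Fin 4 → ℝ) : Fin 4 → ℂ := fun i => (v i : ℂ)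

/-- The complex conjugate vector. -/
def bar (m : Fin 4 → ℂ) : Fin 4 → ℂ := fun i => starRingEnd ℂ (m i)

/-- `(k, l, m, m̄)` is a null tetrad at `p`: `k, l` are real, `g(k,l) = g(m,m̄) = 1`, and all
other products vanish. -/
def IsNullTetrad (g : Tensor2 4) (p : Fin 4 → ℝ) (k l : Fin 4 → ℝ) (m : Fin 4 → ℂ) : Prop :=
  metricC g p (toC k) (toC k) = 0 ∧ metricC g p (toC l) (toC l) = 0 ∧
  metricC g p (toC k) (toC l) = 1 ∧
  metricC g p (toC k) m = 0 ∧ metricC g p (toC l) m = 0 ∧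
  metricC g p m m = 0 ∧ metricC g p m (bar m) = 1

/-- The Weyl scalars `Ψ₀, …, Ψ₄` of a null tetrad. -/
def weylScalar (g : Tensor2 4) (p : Fin 4 → ℝ) (k l : Fin 4 → ℝ) (m : Fin 4 → ℂ) : Fin 5 → ℂ :=
  ![weylC g p (toC k) m (toC k) m,
    weylC g p (toC k) (toC l) (toC k) m,
    weylC g p (toC k) m (toC l) (bar m),
    weylC g p (toC l) (toC k) (toC l) (bar m),
    weylC g p (toC l) (bar m) (toC l) (bar m)]

/-- Petrov type II at `p`: in a suitable null tetrad `Ψ₂` and `Ψ₄` are the nonzero Weyl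
scalars (one double and two simple principal null directions). -/
def IsPetrovII (g : Tensor2 4) (p : Fin 4 → ℝ) : Prop :=
  ∃ (k l : Fin 4 → ℝ) (m : Fin 4 → ℂ), IsNullTetrad g p k l m ∧
    weylScalar g p k l m 0 = 0 ∧ weylScalar g p k l m 1 = 0 ∧ weylScalar g p k l m 2 ≠ 0 ∧
    weylScalar g p k l m 3 = 0 ∧ weylScalar g p k l m 4 ≠ 0

/-- Petrov type D at `p`: in a suitable null tetrad `Ψ₂` is the only nonzero Weyl scalar
(two double principal null directions). -/
def IsPetrovD (g : Tensor2 4) (p : Fin 4 → ℝ) : Prop :=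
  ∃ (k l : Fin 4 → ℝ) (m : Fin 4 → ℂ), IsNullTetrad g p k l m ∧
    weylScalar g p k l m 0 = 0 ∧ weylScalar g p k l m 1 = 0 ∧ weylScalar g p k l m 2 ≠ 0 ∧
    weylScalar g p k l m 3 = 0 ∧ weylScalar g p k l m 4 = 0

/-! ### Sasakian manifolds with a potential

The Sasakian manifold with potential `F : U → ℝ` is the real hypersurface
`M = {(z, u + i v) : z ∈ U, v = F z}` of `ℂ²` with the contact form
`λ' = du - i F_z dz + i F_z̄ dz̄`. It is described in its global coordinates `(x, y, u)`,
`z = x + i y`. Its CR structure is `D = ker λ'`, with the complex coordinate `μ = dz` on `D`. -/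

/-- The complex coordinate `z = x + i y`, the first two real coordinates being `x, y`. -/
def zOf {n : ℕ} (v : Fin (n + 2) → ℝ) : ℂ := ⟨v 0, v 1⟩

/-- The underlying Kähler metric `h = 2 F_{z z̄} dz dz̄ = 2 F_{z z̄} (dx² + dy²)`. -/
def kahlerMetric (F : ℂ → ℝ) : Tensor2 2 :=
  fun v => (2 * mixed F (zOf v)) • (1 : Matrix (Fin 2) (Fin 2) ℝ)

/-- The part of the coordinate space of `(x, y, u)` occupied by `M`. -/
def hypersurface (U : Set ℂ) : Set (Fin 3 → ℝ) := {v | zOf v ∈ U}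

/-- The complex 1-form `μ = dz = dx + i dy` on `M`. -/
def dzForm : (Fin 3 → ℝ) → Fin 3 → ℂ := fun _ => ![1, Complex.I, 0]

/-- The contact form `λ' = du - i F_z dz + i F_z̄ dz̄ = du + 2 Re (-i F_z dz)` on `M`. -/
def contactForm (F : ℂ → ℝ) : (Fin 3 → ℝ) → Fin 3 → ℝ :=
  fun v i => (![0, 0, 1] : Fin 3 → ℝ) i
    + 2 * (-Complex.I * dZ (fun w => (F w : ℂ)) (zOf v) * dzForm v i).re

/-- The rescaled contact form `λ = λ' / (2 F_{z z̄})`, for which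
`dλ = i μ ∧ μ̄ + c μ ∧ λ + c̄ μ̄ ∧ λ`. -/
def rescaledForm (F : ℂ → ℝ) : (Fin 3 → ℝ) → Fin 3 → ℝ :=
  fun v => (1 / (2 * mixed F (zOf v))) • contactForm F v

/-- The exterior derivative `(dθ)_{ij} = ∂_i θ_j - ∂_j θ_i`. -/
def extDeriv1 (θ : (Fin 3 → ℝ) → Fin 3 → ℝ) (i j : Fin 3) (v : Fin 3 → ℝ) : ℝ :=
  pd i (fun x => θ x j) v - pd j (fun x => θ x i) v

/-- The 3-dimensional CR manifold `M` with `D = ker θ` and complex structure on `D` given by the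
complex coordinate `μ` is Sasakian for `θ`: the form `θ` is a contact form, and the Reeb field `Z`
is an infinitesimal CR automorphism, that is, `L_Z μ` vanishes on the `(0,1)`-vectors
(those complex vectors `w` of `D ⊗ ℂ` with `μ(w) = 0`). -/
def IsSasakianOn (M : Set (Fin 3 → ℝ)) (μ : (Fin 3 → ℝ) → Fin 3 → ℂ)
    (θ : (Fin 3 → ℝ) → Fin 3 → ℝ) : Prop :=
  (∀ v ∈ M, ∀ w : Fin 3 → ℝ, ∑ i, θ v i * w i = 0 → ∑ i, μ v i * (w i : ℂ) = 0 → w = 0) ∧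
  (∀ v ∈ M, θ v 0 * extDeriv1 θ 1 2 v + θ v 1 * extDeriv1 θ 2 0 v
    + θ v 2 * extDeriv1 θ 0 1 v ≠ 0) ∧
  ∃ Z : (Fin 3 → ℝ) → Fin 3 → ℝ, ContDiffOn ℝ ∞ Z M ∧ ∀ v ∈ M,
    ∑ i, θ v i * Z v i = 1 ∧ (∀ j, ∑ i, Z v i * extDeriv1 θ i j v = 0) ∧
    ∀ w : Fin 3 → ℂ, ∑ i, (θ v i : ℂ) * w i = 0 → ∑ i, μ v i * w i = 0 →
      ∑ i, (∑ j, ((Z v j : ℂ) * pd j (fun x => μ x i) v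
        + μ v j * (pd i (fun x => Z x j) v : ℂ))) * w i = 0

theorem fderiv_ofReal {F : ℂ → ℝ} {z : ℂ} (h : DifferentiableAt ℝ F z) (e : ℂ) :
    fderiv ℝ (fun w => (F w : ℂ)) z e = (fderiv ℝ F z e : ℂ) := by
  have h1 := (Complex.ofRealCLM.hasFDerivAt (x := F z)).comp z h.hasFDerivAt
  have h2 : fderiv ℝ (fun w => (F w : ℂ)) z = Complex.ofRealCLM.comp (fderiv ℝ F z) := h1.fderiv
  rw [h2]
  rfl

/-- The real expression of `F_{z z̄}`: it equals `(F_xx + F_yy) / 4`. -/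
theorem mixed_eq {U : Set ℂ} (hU : IsOpen U) {F : ℂ → ℝ} (hF : ContDiffOn ℝ ∞ F U)
    {z : ℂ} (hz : z ∈ U) :
    mixed F z = (fderiv ℝ (fun w => fderiv ℝ F w 1) z 1
      + fderiv ℝ (fun w => fderiv ℝ F w Complex.I) z Complex.I) / 4 := by
  have hd : ∀ w ∈ U, DifferentiableAt ℝ F w := fun w hw =>
    (hF.contDiffAt (hU.mem_nhds hw)).differentiableAt (by simp)
  have hd2 : ∀ e : ℂ, DifferentiableAt ℝ (fun w => fderiv ℝ F w e) z := fun e =>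
    (((hF.contDiffAt (hU.mem_nhds hz)).fderiv_right (m := ∞) (by simp)).differentiableAt
      (by simp)).clm_apply (differentiableAt_const e)
  have hc : ∀ e : ℂ, DifferentiableAt ℝ (fun w => ((fderiv ℝ F w e : ℝ) : ℂ)) z := fun e =>
    Complex.ofRealCLM.differentiableAt.comp z (hd2 e)
  have he : dZbar (fun w => (F w : ℂ)) =ᶠ[nhds z]
      fun w => ((2 : ℂ)⁻¹) • (((fderiv ℝ F w 1 : ℝ) : ℂ)
        + Complex.I • ((fderiv ℝ F w Complex.I : ℝ) : ℂ)) := by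
    filter_upwards [hU.mem_nhds hz] with w hw
    simp only [dZbar, fderiv_ofReal (hd w hw), smul_eq_mul]
    ring
  have hf : ∀ e : ℂ, fderiv ℝ (dZbar fun w => (F w : ℂ)) z e
      = (2 : ℂ)⁻¹ * ((fderiv ℝ (fun w => fderiv ℝ F w 1) z e : ℝ)
        + Complex.I * (fderiv ℝ (fun w => fderiv ℝ F w Complex.I) z e : ℝ)) := by
    intro e
    have h1 := (((hc 1).hasFDerivAt.add ((hc Complex.I).hasFDerivAt.const_smul
      Complex.I)).const_smul ((2 : ℂ)⁻¹)).congr_of_eventuallyEq he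
    rw [h1.fderiv]
    simp [fderiv_ofReal (hd2 1), fderiv_ofReal (hd2 Complex.I)]
    ring
  simp only [mixed, dZ, hf]
  simp
  ring

/-- The hypersurface with potential `F` is indeed a Sasakian manifold. -/
theorem hypersurface_isSasakianOn {U : Set ℂ} (hU : IsOpen U) {F : ℂ → ℝ}
    (hF : ContDiffOn ℝ ∞ F U) (hpos : ∀ z ∈ U, 0 < mixed F z) :
    IsSasakianOn (hypersurface U) dzForm (contactForm F) := by
  have hd : ∀ w ∈ U, DifferentiableAt ℝ F w := fun w hw =>
    (hF.contDiffAt (hU.mem_nhds hw)).differentiableAt (by simp)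
  have hd2 : ∀ z ∈ U, ∀ e : ℂ, DifferentiableAt ℝ (fun w => fderiv ℝ F w e) z := fun z hz e =>
    (((hF.contDiffAt (hU.mem_nhds hz)).fderiv_right (m := ∞) (by simp)).differentiableAt
      (by simp)).clm_apply (differentiableAt_const e)
  let L : (Fin 3 → ℝ) →L[ℝ] ℂ :=
    LinearMap.toContinuousLinearMap
      { toFun := fun v => zOf v
        map_add' := fun v w => by apply Complex.ext <;> simp [zOf]
        map_smul' := fun c v => by apply Complex.ext <;> simp [zOf] }
  have hL : ∀ v, L v = zOf v := fun v => rfl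
  have hM : IsOpen (hypersurface U) := hU.preimage L.continuous
  have c0 : ∀ v ∈ hypersurface U, contactForm F v 0 = -fderiv ℝ F (L v) Complex.I := by
    intro v hv
    simp [contactForm, dZ, dzForm, fderiv_ofReal (hd _ hv), hL]
    ring
  have c1 : ∀ v ∈ hypersurface U, contactForm F v 1 = fderiv ℝ F (L v) 1 := by
    intro v hv
    simp [contactForm, dZ, dzForm, fderiv_ofReal (hd _ hv), hL]
    ring
  have c2 : ∀ v, contactForm F v 2 = 1 := by
    intro v
    simp [contactForm, dzForm]
  have p0 : ∀ v ∈ hypersurface U, ∀ i, pd i (fun x => contactForm F x 0) v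
      = -fderiv ℝ (fun w => fderiv ℝ F w Complex.I) (L v) (L (Pi.single i 1)) := by
    intro v hv i
    have : (fun x => contactForm F x 0) =ᶠ[nhds v]
        fun x => -((fun w => fderiv ℝ F w Complex.I) (L x)) := by
      filter_upwards [hM.mem_nhds hv] with x hx using c0 x hx
    have h1 := ((hd2 _ hv Complex.I).hasFDerivAt.comp v L.hasFDerivAt).neg
    have h2 := h1.congr_of_eventuallyEq this
    rw [pd, h2.fderiv]
    rfl
  have p1 : ∀ v ∈ hypersurface U, ∀ i, pd i (fun x => contactForm F x 1) v
      = fderiv ℝ (fun w => fderiv ℝ F w 1) (L v) (L (Pi.single i 1)) := by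
    intro v hv i
    have : (fun x => contactForm F x 1) =ᶠ[nhds v]
        fun x => (fun w => fderiv ℝ F w 1) (L x) := by
      filter_upwards [hM.mem_nhds hv] with x hx using c1 x hx
    have h1 := ((hd2 _ hv 1).hasFDerivAt.comp v L.hasFDerivAt)
    have h2 := h1.congr_of_eventuallyEq this
    rw [pd, h2.fderiv]
    rfl
  have p2 : ∀ v i, pd i (fun x => contactForm F x 2) v = 0 := by
    intro v i
    simp [pd, c2]
  have l0 : L (Pi.single 0 1) = 1 := by apply Complex.ext <;> simp [hL, zOf]
  have l1 : L (Pi.single 1 1) = Complex.I := by apply Complex.ext <;> simp [hL, zOf]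
  have l2 : L (Pi.single 2 1) = 0 := by apply Complex.ext <;> simp [hL, zOf]
  refine ⟨?_, ?_, fun _ => ![0, 0, 1], contDiffOn_const, ?_⟩
  · intro v hv w h1 h2
    have h3 := congrArg Complex.re h2
    have h4 := congrArg Complex.im h2
    simp [Fin.sum_univ_three, dzForm] at h3 h4
    simp [Fin.sum_univ_three, h3, h4, c2] at h1
    funext i
    fin_cases i <;> simp [h1, h3, h4]
  · intro v hv
    have := hpos _ hv
    rw [mixed_eq hU hF hv] at this
    simp only [extDeriv1, p0 v hv, p1 v hv, p2, l0, l1, l2, map_zero, hL]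
    rw [c2]
    intro h
    linarith
  · intro v hv
    refine ⟨?_, ?_, ?_⟩
    · simp [Fin.sum_univ_three, c2]
    · intro j
      fin_cases j <;>
        simp [Fin.sum_univ_three, extDeriv1, p0 v hv, p1 v hv, p2, l2]
    · intro w _ _
      simp [pd, dzForm]

/-! ### Lifts of a CR structure to Lorentzian metrics -/

/-- The pullback to `M × ℝ` (coordinates `(x, y, u, r)`) of a 1-form on `M`. -/
def pull {K : Type*} [Zero K] (α : (Fin 3 → ℝ) → Fin 3 → K) (p : Fin 4 → ℝ) : Fin 4 → K :=
  Fin.snoc (α := fun _ => K) (α fun i => p i.castSucc) 0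

/-- The real 1-form `dr + W μ + W̄ μ̄ + H λ` on `M × ℝ`. -/
def liftForm (μ : (Fin 3 → ℝ) → Fin 3 → ℂ) (lam : (Fin 3 → ℝ) → Fin 3 → ℝ)
    (W : (Fin 4 → ℝ) → ℂ) (H : (Fin 4 → ℝ) → ℝ) (p : Fin 4 → ℝ) : Fin 4 → ℝ :=
  fun i => (Pi.single 3 1 : Fin 4 → ℝ) i + 2 * (W p * pull μ p i).re + H p * pull lam p i

/-- The metric `g = 2 P² (μ μ̄ + λ (dr + W μ + W̄ μ̄ + H λ))` of the family of lifts of the CR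
structure given by `(μ, λ)`; the entries of the symmetric product `μ μ̄` are `Re (μ_i μ̄_j)`. -/
def liftMetric (μ : (Fin 3 → ℝ) → Fin 3 → ℂ) (lam : (Fin 3 → ℝ) → Fin 3 → ℝ)
    (P : (Fin 4 → ℝ) → ℝ) (W : (Fin 4 → ℝ) → ℂ) (H : (Fin 4 → ℝ) → ℝ) : Tensor2 4 :=
  fun p => (2 * P p ^ 2) •
    ((Matrix.of fun i j => (pull μ p i * starRingEnd ℂ (pull μ p j)).re)
      + symProd (pull lam p) (liftForm μ lam W H p))

/-- The vector field `∂/∂r`. -/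
def partialR : (Fin 4 → ℝ) → Fin 4 → ℝ := fun _ => Pi.single 3 1

/-- The frame vector `e₃ = (∂_o - H ∂_r) / P`, where `∂_o = 2 F_{z z̄} ∂_u` is the third vector of
the frame of `M` dual to `(μ, μ̄, λ)`. -/
def frame3 (F : ℂ → ℝ) (P H : (Fin 4 → ℝ) → ℝ) (p : Fin 4 → ℝ) : Fin 4 → ℝ :=
  (1 / P p) • ![0, 0, 2 * mixed F (zOf p), -H p]

/-- The part of the coordinate space of `(x, y, u, r)` on which the lift is defined:
`z ∈ U` and `cos (r/2) ≠ 0`. -/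
def spacetime (U : Set ℂ) : Set (Fin 4 → ℝ) := {p | zOf p ∈ U ∧ Real.cos (p 3 / 2) ≠ 0}

/-- The conformal factor `P = p / cos (r/2)` with `p = q √(F_{z z̄})`. -/
def conformalFactor (F : ℂ → ℝ) (q : ℂ → ℝ) (p : Fin 4 → ℝ) : ℝ :=
  q (zOf p) * √(mixed F (zOf p)) / Real.cos (p 3 / 2)

/-- The logistic equation `q_{z z̄} + a q = b q³` on `U`, with `a = -(1/4) ∂_z∂_z̄ log F_{z z̄}`
and `b = (Λ/3) F_{z z̄}`. -/
def SolvesLogisticOn (F : ℂ → ℝ) (Λ : ℝ) (U : Set ℂ) (q : ℂ → ℝ) : Prop :=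
  ∀ z ∈ U, mixed q z + (-(1 / 4) * mixed (fun w => Real.log (mixed F w)) z) * q z
    = (Λ / 3 * mixed F z) * q z ^ 3

end ShearfreeLift

end

/-! Take `W = 0`, write f for the mixed derivative of `F`, and put t = tan(r/2), Q = q², b = Λo/4.
Since 1/cos²(r/2) = 1 + t² and (1 + t²) dr/2 = dt, the choice H = 2f (b + t/(1 + t²)²) turns the
lift into Q (2f (1 + t²)(dx² + dy²) + B(t) λ'² + 2 λ' dt), with B(t) = b (1 + t²) + t/(1 + t²) and
dλ' = 4f dx ∧ dy, a metric of Taub-NUT type over the Kähler base. All claims are read off from this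
form.

The Einstein equations reduce to three facts. The Kähler-Einstein condition says that the Laplacian
of log f is -4 Λo f = -16 b f; the constant q satisfies Λ q² = 3b; and B solves two linear ODEs
(`e1` and `e2` in `pointCurvature_ricci`), whose common solutions include b (1 + t²) + m t/(1 + t²)
for every constant m. The logistic equation for constant q is again Λ q² = 3b. The value m = 1 is
used, since m = 0 would make the Weyl scalar Ψ₂ vanish.

The field ∂_r is null and dual to a multiple of λ'. Its flow scales every part of g at the rate t,
except for the λ'² term, which is absorbed in θψ. The vector e₃ is null, so Ric(e₃, e₃) = Λ g(e₃,
e₃) = 0. In the null tetrad built from ∂_t, its null partner in the (λ', t)-plane, and the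
(1,0)-direction of the base, only Ψ₂ = -1/(2Q (t - i)³) survives, and it has no real zero: the type
is D everywhere.

Curvature is computed in the coframe dx, dy, λ', dt. A general moving-frame argument
(`christoffel_eq`, `riemann_eq`) identifies the coordinate curvature with that of explicitly given
connection matrices; metric compatibility and the torsion equation certify the matrices, so that
only rational identities in t remain (`pointCurvature_ricci`, `pointRiemann_eq`). -/

noncomputable section
namespace ShearfreeLift

/-! ### Partial derivatives -/

section PartialDerivatives

variable {n : ℕ} {p : Fin n → ℝ}

theorem pd_congr {f g : (Fin n → ℝ) → ℝ} (h : f =ᶠ[nhds p] g) (i : Fin n) :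
    pd i f p = pd i g p := by
  rw [pd, pd, h.fderiv_eq]

theorem pd_const (c : ℝ) (i : Fin n) : pd i (fun _ => c) p = 0 := by
  simp [pd]

theorem pd_add {f g : (Fin n → ℝ) → ℝ} (hf : DifferentiableAt ℝ f p)
    (hg : DifferentiableAt ℝ g p) (i : Fin n) :
    pd i (fun x => f x + g x) p = pd i f p + pd i g p := by
  simp only [pd, fderiv_fun_add hf hg, add_apply]

theorem pd_mul {f g : (Fin n → ℝ) → ℝ} (hf : DifferentiableAt ℝ f p)
    (hg : DifferentiableAt ℝ g p) (i : Fin n) :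
    pd i (fun x => f x * g x) p = pd i f p * g p + f p * pd i g p := by
  simp only [pd, fderiv_fun_mul hf hg, add_apply,
    smul_apply, smul_eq_mul]
  ring

theorem pd_sum {ι : Type*} (s : Finset ι) {f : ι → (Fin n → ℝ) → ℝ}
    (hf : ∀ a ∈ s, DifferentiableAt ℝ (f a) p) (i : Fin n) :
    pd i (fun x => ∑ a ∈ s, f a x) p = ∑ a ∈ s, pd i (f a) p := by
  simp only [pd, fderiv_fun_sum hf, sum_apply]

theorem differentiableAt_pd {f : (Fin n → ℝ) → ℝ} (hf : ContDiffAt ℝ ∞ f p) (i : Fin n) :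
    DifferentiableAt ℝ (pd i f) p :=
  ((hf.fderiv_right (m := ∞) (by simp)).differentiableAt (by simp)).clm_apply
    (differentiableAt_const _)

theorem fderiv_fderiv_comm {E : Type*} [NormedAddCommGroup E] [NormedSpace ℝ E]
    {f : E → ℝ} {x : E} (hf : ContDiffAt ℝ ∞ f x) (v w : E) :
    fderiv ℝ (fun y => fderiv ℝ f y v) x w = fderiv ℝ (fun y => fderiv ℝ f y w) x v := by
  have hd : DifferentiableAt ℝ (fderiv ℝ f) x :=
    (hf.fderiv_right (m := ∞) (by simp)).differentiableAt (by simp)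
  have h1 : ∀ v : E, fderiv ℝ (fun y => fderiv ℝ f y v) x
      = (fderiv ℝ (fderiv ℝ f) x).flip v := fun v => by
    rw [fderiv_clm_apply hd (differentiableAt_const v)]
    simp
  -- Schwarz's theorem; over `ℝ` the order of smoothness it asks for is 2.
  have hs : IsSymmSndFDerivAt ℝ f x := hf.isSymmSndFDerivAt (by
    rw [minSmoothness_of_isRCLikeNormedField]
    exact WithTop.coe_le_coe.2 (le_top : (2 : ℕ∞) ≤ ⊤))
  rw [h1, h1]
  exact hs.eq w v

theorem pd_pd_comm {f : (Fin n → ℝ) → ℝ} (hf : ContDiffAt ℝ ∞ f p) (i j : Fin n) :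
    pd i (pd j f) p = pd j (pd i f) p :=
  fderiv_fderiv_comm hf _ _

/-- The entrywise partial derivative of a matrix of functions. -/
def pdM (k : Fin n) (M : Tensor2 n) : Tensor2 n :=
  fun p => Matrix.of fun a b => pd k (fun x => M x a b) p

theorem pdM_congr {M N : Tensor2 n} (h : M =ᶠ[nhds p] N) (k : Fin n) :
    pdM k M p = pdM k N p := by
  ext a b
  exact pd_congr (h.mono fun x hx => by rw [hx]) k

theorem pdM_const (N : Matrix (Fin n) (Fin n) ℝ) (k : Fin n) : pdM k (fun _ => N) p = 0 := by
  ext a b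
  exact pd_const _ k

theorem pdM_add {M N : Tensor2 n} (hM : ∀ a b, DifferentiableAt ℝ (fun x => M x a b) p)
    (hN : ∀ a b, DifferentiableAt ℝ (fun x => N x a b) p) (k : Fin n) :
    pdM k (fun x => M x + N x) p = pdM k M p + pdM k N p := by
  ext a b
  exact pd_add (hM a b) (hN a b) k

theorem differentiableAt_matrix_mul {M N : Tensor2 n}
    (hM : ∀ a b, DifferentiableAt ℝ (fun x => M x a b) p)
    (hN : ∀ a b, DifferentiableAt ℝ (fun x => N x a b) p) (a b : Fin n) :
    DifferentiableAt ℝ (fun x => (M x * N x) a b) p := by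
  simp only [Matrix.mul_apply]
  exact DifferentiableAt.fun_sum fun i _ => (hM a i).fun_mul (hN i b)

theorem pdM_mul {M N : Tensor2 n} (hM : ∀ a b, DifferentiableAt ℝ (fun x => M x a b) p)
    (hN : ∀ a b, DifferentiableAt ℝ (fun x => N x a b) p) (k : Fin n) :
    pdM k (fun x => M x * N x) p = pdM k M p * N p + M p * pdM k N p := by
  ext a b
  simp only [pdM, Matrix.of_apply, Matrix.mul_apply, Matrix.add_apply]
  rw [pd_sum _ fun i _ => (hM a i).fun_mul (hN i b), ← Finset.sum_add_distrib]
  exact Finset.sum_congr rfl fun i _ => pd_mul (hM a i) (hN i b) k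

theorem pdM_transpose (M : Tensor2 n) (k : Fin n) :
    pdM k (fun x => (M x)ᵀ) p = (pdM k M p)ᵀ := rfl

end PartialDerivatives

/-! ### The Levi-Civita connection in a moving frame -/

section MovingFrame

variable {n : ℕ}

/-- Uniqueness of the Levi-Civita connection, by Koszul's argument. Compatibility expands the three
derivatives of g into six sums; symmetry of Γ in its lower indices cancels four of them and leaves 2
g Γ_j. -/
theorem christoffel_eq_of_compatible {g : Tensor2 n} {p : Fin n → ℝ} (hsymm : (g p).IsSymm)
    (hdet : IsUnit (g p).det) {Γ : Fin n → Matrix (Fin n) (Fin n) ℝ}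
    (hcompat : ∀ j, pdM j g p = (Γ j)ᵀ * g p + g p * Γ j)
    (htorsion : ∀ i j k, Γ j i k = Γ k i j) (i j k : Fin n) :
    christoffel g i j k p = Γ j i k := by
  have hc : ∀ j k l, pd j (fun x => g x k l) p
      = ∑ m, (Γ j m k * g p m l + g p k m * Γ j m l) := fun j k l => by
    have := congrFun (congrFun (hcompat j) k) l
    simp only [pdM, Matrix.of_apply, Matrix.add_apply, Matrix.mul_apply,
      Matrix.transpose_apply] at this
    rw [this, Finset.sum_add_distrib]
  have hl : ∀ l, pd j (fun x => g x l k) p + pd k (fun x => g x j l) p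
      - pd l (fun x => g x j k) p = 2 * (g p * Γ j) l k := fun l => by
    rw [hc, hc, hc, Matrix.mul_apply, Finset.mul_sum, ← Finset.sum_add_distrib,
      ← Finset.sum_sub_distrib]
    refine Finset.sum_congr rfl fun m _ => ?_
    rw [htorsion m j l, htorsion m k j, htorsion m k l, hsymm.apply l m]
    ring
  have h2 : (1 / 2 : ℝ) * ∑ l, (g p)⁻¹ i l * (2 * (g p * Γ j) l k)
      = ((g p)⁻¹ * (g p * Γ j)) i k := by
    rw [Matrix.mul_apply, Finset.mul_sum]
    exact Finset.sum_congr rfl fun l _ => by ring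
  simp only [christoffel, hl]
  rw [h2, ← Matrix.mul_assoc, Matrix.nonsing_inv_mul _ hdet, Matrix.one_mul]

/-- The metric `g` is given on `S` by its matrix `η` in the coframe `θ` (with dual frame `E`).
The structure functions are `dθᵉ = ½ τᵉ_{cd} θᶜ ∧ θᵈ`, the connection matrices of the frame
vectors are `ν c`, and `Dν c d` is the derivative of `ν d` along the frame vector `c`. -/
structure IsMovingFrame (g : Tensor2 n) (S : Set (Fin n → ℝ)) (θ E η : Tensor2 n)
    (ν : Fin n → Tensor2 n) (Dν : Fin n → Fin n → Tensor2 n)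
    (τ : (Fin n → ℝ) → Fin n → Fin n → Fin n → ℝ) : Prop where
  isOpen : IsOpen S
  coframe_smooth : ∀ a b, ContDiffOn ℝ ∞ (fun x => θ x a b) S
  frame_smooth : ∀ a b, ContDiffOn ℝ ∞ (fun x => E x a b) S
  frame_mul_coframe : ∀ p ∈ S, E p * θ p = 1
  metric_eq : ∀ p ∈ S, g p = (θ p)ᵀ * η p * θ p
  metric_symm : ∀ p ∈ S, (η p).IsSymm
  metric_det : ∀ p ∈ S, IsUnit (η p).det
  metric_diff : ∀ p ∈ S, ∀ a b, DifferentiableAt ℝ (fun x => η x a b) p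
  connection_diff : ∀ p ∈ S, ∀ c a b, DifferentiableAt ℝ (fun x => ν c x a b) p
  structure_eq : ∀ p ∈ S, ∀ e k l, pd k (fun x => θ x e l) p - pd l (fun x => θ x e k) p
    = ∑ c, ∑ d, θ p c k * θ p d l * τ p c d e
  compatible : ∀ p ∈ S, ∀ k,
    pdM k η p = ∑ c, θ p c k • ((ν c p)ᵀ * η p + η p * ν c p)
  torsion_free : ∀ p ∈ S, ∀ c d e, ν c p e d - ν d p e c = -τ p c d e
  connection_deriv : ∀ p ∈ S, ∀ d k, pdM k (ν d) p = ∑ c, θ p c k • Dν c d p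

/-- The curvature of the connection `ν` on a pair of frame vectors. -/
def frameCurvature (ν : Fin n → Tensor2 n) (Dν : Fin n → Fin n → Tensor2 n)
    (τ : (Fin n → ℝ) → Fin n → Fin n → Fin n → ℝ) (c d : Fin n) : Tensor2 n :=
  fun p => Dν c d p - Dν d c p + ν c p * ν d p - ν d p * ν c p + ∑ e, τ p c d e • ν e p

namespace IsMovingFrame

variable {g : Tensor2 n} {S : Set (Fin n → ℝ)} {θ E η : Tensor2 n}
    {ν : Fin n → Tensor2 n} {Dν : Fin n → Fin n → Tensor2 n}
    {τ : (Fin n → ℝ) → Fin n → Fin n → Fin n → ℝ} {p : Fin n → ℝ}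

theorem coframe_mul_frame (h : IsMovingFrame g S θ E η ν Dν τ) (hp : p ∈ S) :
    θ p * E p = 1 :=
  mul_eq_one_comm.mp (h.frame_mul_coframe p hp)

theorem coframe_contDiffAt (h : IsMovingFrame g S θ E η ν Dν τ) (hp : p ∈ S) (a b : Fin n) :
    ContDiffAt ℝ ∞ (fun x => θ x a b) p :=
  (h.coframe_smooth a b).contDiffAt (h.isOpen.mem_nhds hp)

theorem coframe_diff (h : IsMovingFrame g S θ E η ν Dν τ) (hp : p ∈ S) (a b : Fin n) :
    DifferentiableAt ℝ (fun x => θ x a b) p :=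
  (h.coframe_contDiffAt hp a b).differentiableAt (by simp)

theorem frame_diff (h : IsMovingFrame g S θ E η ν Dν τ) (hp : p ∈ S) (a b : Fin n) :
    DifferentiableAt ℝ (fun x => E x a b) p :=
  ((h.frame_smooth a b).contDiffAt (h.isOpen.mem_nhds hp)).differentiableAt (by simp)

/-- The connection matrix of a coordinate vector. -/
def coordConnection (θ : Tensor2 n) (ν : Fin n → Tensor2 n) (k : Fin n) : Tensor2 n :=
  fun p => ∑ c, θ p c k • ν c p

theorem coordConnection_apply (θ : Tensor2 n) (ν : Fin n → Tensor2 n) (k a b : Fin n)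
    (x : Fin n → ℝ) : coordConnection θ ν k x a b = ∑ c, θ x c k * ν c x a b := by
  simp [coordConnection, Matrix.sum_apply]

/-- The gauge transformation law. With A_j the connection matrix along ∂_j, the coordinate vectors
are frame combinations with coefficients θ, so ∇_j has coefficient matrix ∂_jθ + A_jθ in the frame,
and `E` converts back. By uniqueness it suffices to check compatibility and symmetry. -/
theorem christoffel_eq (h : IsMovingFrame g S θ E η ν Dν τ) (hp : p ∈ S) (i j k : Fin n) :
    christoffel g i j k p
      = (E p * (pdM j θ p + coordConnection θ ν j p * θ p)) i k := by
  have hEθ := h.frame_mul_coframe p hp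
  have hθE := h.coframe_mul_frame hp
  have hev : g =ᶠ[nhds p] fun x => (θ x)ᵀ * η x * θ x := by
    filter_upwards [h.isOpen.mem_nhds hp] with x hx using h.metric_eq x hx
  refine christoffel_eq_of_compatible
    (Γ := fun j => E p * (pdM j θ p + coordConnection θ ν j p * θ p)) ?_ ?_ ?_ ?_ i j k
  · rw [h.metric_eq p hp]
    unfold Matrix.IsSymm
    simp [Matrix.mul_assoc, (h.metric_symm p hp).eq]
  · rw [h.metric_eq p hp, Matrix.det_mul, Matrix.det_mul, Matrix.det_transpose]
    have : IsUnit (θ p).det := Matrix.isUnit_det_of_left_inverse hEθ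
    exact (this.mul (h.metric_det p hp)).mul this
  · intro j
    have hT : ∀ a b, DifferentiableAt ℝ (fun x => (θ x)ᵀ a b) p :=
      fun a b => h.coframe_diff hp b a
    rw [pdM_congr hev, pdM_mul (differentiableAt_matrix_mul hT (h.metric_diff p hp))
      (h.coframe_diff hp), pdM_mul hT (h.metric_diff p hp), pdM_transpose]
    have hη : pdM j η p = (coordConnection θ ν j p)ᵀ * η p + η p * coordConnection θ ν j p := by
      rw [h.compatible p hp, coordConnection]
      simp only [Matrix.transpose_sum, Matrix.transpose_smul, Matrix.sum_mul, Matrix.mul_sum,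
        Matrix.smul_mul, Matrix.mul_smul, smul_add, Finset.sum_add_distrib]
    rw [hη, h.metric_eq p hp]
    generalize coordConnection θ ν j p = A
    have h1 : (E p)ᵀ * (θ p)ᵀ = 1 := by rw [← Matrix.transpose_mul, hθE, Matrix.transpose_one]
    simp only [Matrix.transpose_mul, Matrix.transpose_add]
    have e1 : ((pdM j θ p)ᵀ + (θ p)ᵀ * Aᵀ) * (E p)ᵀ * ((θ p)ᵀ * η p * θ p)
        = ((pdM j θ p)ᵀ + (θ p)ᵀ * Aᵀ) * ((E p)ᵀ * (θ p)ᵀ) * (η p * θ p) := by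
      noncomm_ring
    have e2 : (θ p)ᵀ * η p * θ p * (E p * (pdM j θ p + A * θ p))
        = (θ p)ᵀ * η p * (θ p * E p) * (pdM j θ p + A * θ p) := by
      noncomm_ring
    rw [e1, e2, h1, hθE]
    noncomm_ring
  -- Symmetry in j, k: the antisymmetric part of ∂_jθ is given by the structure functions, that of
  -- A_jθ by minus them.
  · intro i j k
    simp only [Matrix.mul_apply (M := E p)]
    refine Finset.sum_congr rfl fun a _ => ?_
    congr 1
    have h1 := h.structure_eq p hp a j k
    have h2 : (coordConnection θ ν j p * θ p) a k - (coordConnection θ ν k p * θ p) a j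
        = ∑ c, ∑ d, θ p c j * θ p d k * (ν c p a d - ν d p a c) := by
      simp only [Matrix.mul_apply, coordConnection_apply, mul_sub, Finset.sum_sub_distrib]
      congr 1
      · rw [Finset.sum_comm]
        refine Finset.sum_congr rfl fun c _ => ?_
        rw [Finset.sum_mul]
        exact Finset.sum_congr rfl fun d _ => by ring
      · refine Finset.sum_congr rfl fun c _ => ?_
        rw [Finset.sum_mul]
        exact Finset.sum_congr rfl fun d _ => by ring
    simp only [h.torsion_free p hp, mul_neg, Finset.sum_neg_distrib, ← h1] at h2
    simp only [Matrix.add_apply, pdM, Matrix.of_apply]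
    linarith

theorem coordConnection_diff (h : IsMovingFrame g S θ E η ν Dν τ) (hp : p ∈ S)
    (k a b : Fin n) : DifferentiableAt ℝ (fun x => coordConnection θ ν k x a b) p := by
  simp only [coordConnection_apply]
  exact DifferentiableAt.fun_sum fun c _ => (h.coframe_diff hp c k).fun_mul
    (h.connection_diff p hp c a b)

theorem pdM_coordConnection (h : IsMovingFrame g S θ E η ν Dν τ) (hp : p ∈ S)
    (k l : Fin n) : pdM k (coordConnection θ ν l) p
      = ∑ d, pd k (fun x => θ x d l) p • ν d p
        + ∑ c, ∑ d, (θ p c k * θ p d l) • Dν c d p := by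
  have hD : ∀ d a b, pd k (fun x => ν d x a b) p = ∑ c, θ p c k * Dν c d p a b :=
    fun d a b => by
      have := congrFun (congrFun (h.connection_deriv p hp d k) a) b
      simpa [pdM, Matrix.sum_apply] using this
  ext a b
  simp only [pdM, Matrix.of_apply, coordConnection_apply, Matrix.add_apply, Matrix.sum_apply,
    Matrix.smul_apply, smul_eq_mul]
  rw [pd_sum _ fun c _ => (h.coframe_diff hp c l).fun_mul (h.connection_diff p hp c a b),
    Finset.sum_comm, ← Finset.sum_add_distrib]
  refine Finset.sum_congr rfl fun d _ => ?_
  rw [pd_mul (h.coframe_diff hp d l) (h.connection_diff p hp d a b), hD, Finset.mul_sum]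
  congr 1
  exact Finset.sum_congr rfl fun c _ => by ring

/-- Cartan's second structure equation. Differentiating A_l = Σ θᵈ_l ν_d also hits the coframe;
antisymmetrised, this produces the `τ` term of `frameCurvature`, which stands for -ν along the
bracket of the frame vectors. -/
theorem coordCurvature (h : IsMovingFrame g S θ E η ν Dν τ) (hp : p ∈ S) (k l : Fin n) :
    pdM k (coordConnection θ ν l) p - pdM l (coordConnection θ ν k) p
      + coordConnection θ ν k p * coordConnection θ ν l p
      - coordConnection θ ν l p * coordConnection θ ν k p
      = ∑ c, ∑ d, (θ p c k * θ p d l) • frameCurvature ν Dν τ c d p := by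
  have h1 : coordConnection θ ν k p * coordConnection θ ν l p
      = ∑ c, ∑ d, (θ p c k * θ p d l) • (ν c p * ν d p) := by
    simp only [coordConnection, Matrix.sum_mul, Matrix.mul_sum, Matrix.smul_mul,
      Matrix.mul_smul, Finset.smul_sum, smul_smul]
    rw [Finset.sum_comm]
    exact Finset.sum_congr rfl fun c _ => Finset.sum_congr rfl fun d _ => by
      rw [mul_comm]
  have h2 : coordConnection θ ν l p * coordConnection θ ν k p
      = ∑ c, ∑ d, (θ p c k * θ p d l) • (ν d p * ν c p) := by
    simp only [coordConnection, Matrix.sum_mul, Matrix.mul_sum, Matrix.smul_mul,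
      Matrix.mul_smul, Finset.smul_sum, smul_smul]
  have h3 : ∑ d, pd k (fun x => θ x d l) p • ν d p - ∑ d, pd l (fun x => θ x d k) p • ν d p
      = ∑ c, ∑ d, (θ p c k * θ p d l) • ∑ e, τ p c d e • ν e p := by
    simp only [← Finset.sum_sub_distrib, ← sub_smul, h.structure_eq p hp, Finset.sum_smul,
      Finset.smul_sum, smul_smul]
    rw [Finset.sum_comm]
    exact Finset.sum_congr rfl fun c _ => Finset.sum_comm
  have h4 : ∑ c, ∑ d, (θ p c l * θ p d k) • Dν c d p
      = ∑ c, ∑ d, (θ p c k * θ p d l) • Dν d c p := by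
    rw [Finset.sum_comm]
    exact Finset.sum_congr rfl fun c _ => Finset.sum_congr rfl fun d _ => by rw [mul_comm]
  simp only [frameCurvature, smul_add, smul_sub, Finset.sum_add_distrib,
    Finset.sum_sub_distrib]
  rw [h.pdM_coordConnection hp, h.pdM_coordConnection hp, h1, h2, ← h3, h4]
  abel

/-- The Riemann tensor from the curvature of the frame. -/
theorem riemann_eq (h : IsMovingFrame g S θ E η ν Dν τ) (hp : p ∈ S) (i j k l : Fin n) :
    riemann g i j k l p
      = (E p * (∑ c, ∑ d, (θ p c k * θ p d l) • frameCurvature ν Dν τ c d p) * θ p) i j := by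
  have hEθ := h.frame_mul_coframe p hp
  have hθE := h.coframe_mul_frame hp
  have hdθ : ∀ l a b, DifferentiableAt ℝ (fun x => pdM l θ x a b) p := fun l a b =>
    differentiableAt_pd (h.coframe_contDiffAt hp a b) l
  have hdνθ : ∀ l a b, DifferentiableAt ℝ (fun x => (coordConnection θ ν l x * θ x) a b) p :=
    fun l => differentiableAt_matrix_mul (h.coordConnection_diff hp l) (h.coframe_diff hp)
  have hΓ : ∀ k l, pd k (christoffel g i l j) p
      = pdM k (fun x => E x * (pdM l θ x + coordConnection θ ν l x * θ x)) p i j := by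
    intro k l
    refine pd_congr ?_ k
    filter_upwards [h.isOpen.mem_nhds hp] with x hx using h.christoffel_eq hx i l j
  have hΓ' : ∀ k l, pdM k (fun x => E x * (pdM l θ x + coordConnection θ ν l x * θ x)) p
      = pdM k E p * (pdM l θ p + coordConnection θ ν l p * θ p)
        + E p * (pdM k (pdM l θ) p + (pdM k (coordConnection θ ν l) p * θ p
          + coordConnection θ ν l p * pdM k θ p)) := by
    intro k l
    rw [pdM_mul (N := fun x => pdM l θ x + coordConnection θ ν l x * θ x) (h.frame_diff hp)
      (fun a b => (hdθ l a b).fun_add (hdνθ l a b)),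
      pdM_add (hdθ l) (hdνθ l), pdM_mul (h.coordConnection_diff hp l) (h.coframe_diff hp)]
  -- Derivative of an inverse matrix, from differentiating Eθ = 1.
  have hE : ∀ k, pdM k E p = -(E p * pdM k θ p * E p) := by
    intro k
    have h1 : pdM k (fun x => E x * θ x) p = 0 := by
      rw [← pdM_const (p := p) (1 : Matrix (Fin n) (Fin n) ℝ) k]
      refine pdM_congr ?_ k
      filter_upwards [h.isOpen.mem_nhds hp] with x hx using h.frame_mul_coframe x hx
    rw [pdM_mul (h.frame_diff hp) (h.coframe_diff hp)] at h1
    have h2 := eq_neg_of_add_eq_zero_left h1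
    calc pdM k E p = pdM k E p * θ p * E p := by rw [Matrix.mul_assoc, hθE, Matrix.mul_one]
      _ = _ := by rw [h2, Matrix.neg_mul]
  have hcomm : pdM k (pdM l θ) p = pdM l (pdM k θ) p := by
    ext a b
    exact pd_pd_comm (h.coframe_contDiffAt hp a b) k l
  have hprod : ∀ k l, ∑ m, christoffel g i k m p * christoffel g m l j p
      = ((E p * (pdM k θ p + coordConnection θ ν k p * θ p))
        * (E p * (pdM l θ p + coordConnection θ ν l p * θ p))) i j := by
    intro k l
    rw [Matrix.mul_apply]
    exact Finset.sum_congr rfl fun m _ => by rw [h.christoffel_eq hp, h.christoffel_eq hp]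
  rw [← h.coordCurvature hp, riemann, Finset.sum_sub_distrib, hprod, hprod, hΓ, hΓ, hΓ', hΓ',
    hE, hE, hcomm, ← Matrix.sub_apply, ← Matrix.sub_apply, ← Matrix.add_apply]
  refine congrFun (congrFun ?_ i) j
  generalize coordConnection θ ν k p = A
  generalize coordConnection θ ν l p = B
  generalize pdM k (coordConnection θ ν l) p = A'
  generalize pdM l (coordConnection θ ν k) p = B'
  -- The first summand cancels the term that comes from the derivative of `E`, the second cancels a
  -- term A_k ∂_lθ; the third is the quadratic part of the curvature.
  have key : ∀ X Y A B : Matrix (Fin n) (Fin n) ℝ,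
      E p * (X + A * θ p) * (E p * (Y + B * θ p)) = E p * X * E p * (Y + B * θ p)
        + E p * A * Y + E p * A * B * θ p := by
    intro X Y A B
    have : E p * (X + A * θ p) * (E p * (Y + B * θ p)) = E p * X * E p * (Y + B * θ p)
        + E p * A * (θ p * E p) * (Y + B * θ p) := by noncomm_ring
    rw [this, hθE]
    noncomm_ring
  rw [key, key]
  noncomm_ring

end IsMovingFrame
end MovingFrame

/-! ### Ricci and Weyl tensors in a moving frame -/

section FrameTensors

variable {n : ℕ}

theorem sum_comm_pairs (f : Fin n → Fin n → Fin n → Fin n → ℂ) :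
    ∑ a, ∑ b, ∑ c, ∑ d, f a b c d = ∑ c, ∑ d, ∑ a, ∑ b, f a b c d := by
  have h1 := Finset.sum_comm (s := (Finset.univ : Finset (Fin n × Fin n)))
    (t := (Finset.univ : Finset (Fin n × Fin n))) (f := fun x y => f x.1 x.2 y.1 y.2)
  simpa only [Fintype.sum_prod_type] using h1

/-- Passes from coordinate components to frame components in two slots at once; four-index tensors
are treated by using it twice. -/
theorem sum_congruence_contract (Θ M : Matrix (Fin n) (Fin n) ℂ) (v w : Fin n → ℂ) :
    ∑ i, ∑ j, (∑ a, ∑ b, Θ a i * Θ b j * M a b) * v i * w j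
      = ∑ a, ∑ b, M a b * (Θ *ᵥ v) a * (Θ *ᵥ w) b := by
  have h1 : ∀ (N : Matrix (Fin n) (Fin n) ℂ) (x y : Fin n → ℂ),
      ∑ i, ∑ j, N i j * x i * y j = x ⬝ᵥ N *ᵥ y := fun N x y => by
    simp only [dotProduct, Matrix.mulVec, Finset.mul_sum]
    exact Finset.sum_congr rfl fun i _ => Finset.sum_congr rfl fun j _ => by ring
  have h2 : ∀ i j, ∑ a, ∑ b, Θ a i * Θ b j * M a b = (Θᵀ * M * Θ) i j := fun i j => by
    simp only [Matrix.mul_apply, Matrix.transpose_apply, Finset.sum_mul]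
    rw [Finset.sum_comm]
    exact Finset.sum_congr rfl fun i _ => Finset.sum_congr rfl fun j _ => by ring
  simp only [h2]
  rw [h1, h1, ← Matrix.mulVec_mulVec, ← Matrix.mulVec_mulVec, Matrix.dotProduct_mulVec,
    Matrix.vecMul_transpose]

namespace IsMovingFrame

variable {g : Tensor2 n} {S : Set (Fin n → ℝ)} {θ E η : Tensor2 n}
    {ν : Fin n → Tensor2 n} {Dν : Fin n → Fin n → Tensor2 n}
    {τ : (Fin n → ℝ) → Fin n → Fin n → Fin n → ℝ} {p : Fin n → ℝ}

/-- The contracted upper index carries `E` and the contracted lower index carries `θ`; these cancel,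
so the trace can be taken in the frame. -/
theorem ricci_eq (h : IsMovingFrame g S θ E η ν Dν τ) (hp : p ∈ S) :
    ricci g p = (θ p)ᵀ * (Matrix.of fun b d => ∑ a, frameCurvature ν Dν τ a d p a b) * θ p := by
  have hθE := h.coframe_mul_frame hp
  ext j l
  have h1 : ∀ i, riemann g i j i l p = ∑ d, ∑ b, ∑ a, ∑ c,
      (θ p c i * E p i a) * (θ p d l * θ p b j * frameCurvature ν Dν τ c d p a b) := fun i => by
    rw [h.riemann_eq hp]
    simp only [Matrix.mul_apply, Matrix.sum_apply, Matrix.smul_apply, smul_eq_mul,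
      Finset.sum_mul, Finset.mul_sum]
    rw [Finset.sum_comm' (s' := fun _ => Finset.univ) (t' := Finset.univ) (by simp)]
    conv_lhs =>
      enter [2, a]
      rw [Finset.sum_comm]
    rw [Finset.sum_comm]
    refine Finset.sum_congr rfl fun c _ => ?_
    rw [Finset.sum_comm]
    refine Finset.sum_congr rfl fun b _ => ?_
    rw [Finset.sum_comm]
    exact Finset.sum_congr rfl fun d _ => Finset.sum_congr rfl fun a _ => by ring
  have h2 : ∀ c a, ∑ i, θ p c i * E p i a = if c = a then 1 else 0 := fun c a => by
    rw [← Matrix.mul_apply, hθE, Matrix.one_apply]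
  have h3 : ricci g p j l = ∑ d, ∑ b, ∑ a, ∑ c, (∑ i, θ p c i * E p i a)
      * (θ p d l * θ p b j * frameCurvature ν Dν τ c d p a b) := by
    simp only [ricci, Matrix.of_apply, h1, Finset.sum_mul]
    rw [Finset.sum_comm]
    refine Finset.sum_congr rfl fun c _ => ?_
    rw [Finset.sum_comm]
    refine Finset.sum_congr rfl fun b _ => ?_
    rw [Finset.sum_comm]
    refine Finset.sum_congr rfl fun d _ => ?_
    rw [Finset.sum_comm]
  rw [h3]
  simp only [h2, ite_mul, one_mul, zero_mul, Finset.sum_ite_eq', Finset.mem_univ, if_true,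
    Matrix.mul_apply, Matrix.transpose_apply, Matrix.of_apply, Finset.sum_mul, Finset.mul_sum]
  exact Finset.sum_congr rfl fun d _ => Finset.sum_congr rfl fun b _ =>
    Finset.sum_congr rfl fun c _ => by ring

theorem isEinsteinOn (h : IsMovingFrame g S θ E η ν Dν τ) {Λ : ℝ}
    (hR : ∀ p ∈ S, ∀ b d, ∑ a, frameCurvature ν Dν τ a d p a b = Λ * η p b d) :
    IsEinsteinOn g S Λ := by
  intro p hp
  have h1 : (Matrix.of fun b d => ∑ a, frameCurvature ν Dν τ a d p a b) = Λ • η p := by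
    ext b d
    simp [hR p hp]
  rw [h.ricci_eq hp, h1, h.metric_eq p hp, Matrix.mul_smul, Matrix.smul_mul]

theorem lowered_riemann_eq (h : IsMovingFrame g S θ E η ν Dν τ) (hp : p ∈ S)
    (i j k l : Fin n) : ∑ m, g p i m * riemann g m j k l p
      = ∑ a, ∑ b, θ p a i * θ p b j * ∑ c, ∑ d, θ p c k * θ p d l
        * (η p * frameCurvature ν Dν τ c d p) a b := by
  have hθE := h.coframe_mul_frame hp
  simp only [h.riemann_eq hp]
  rw [← Matrix.mul_apply, h.metric_eq p hp]
  have h1 : ∀ X : Matrix (Fin n) (Fin n) ℝ, (θ p)ᵀ * η p * θ p * (E p * X * θ p)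
      = (θ p)ᵀ * (η p * X) * θ p := fun X => by
    calc _ = (θ p)ᵀ * η p * (θ p * E p) * X * θ p := by noncomm_ring
      _ = _ := by rw [hθE]; noncomm_ring
  have h2 : ∀ a b, ∑ c, ∑ d, θ p c k * θ p d l * (η p * frameCurvature ν Dν τ c d p) a b
      = (η p * ∑ c, ∑ d, (θ p c k * θ p d l) • frameCurvature ν Dν τ c d p) a b := fun a b => by
    simp only [Matrix.mul_sum, Matrix.mul_smul, Matrix.sum_apply, Matrix.smul_apply, smul_eq_mul]
  rw [h1]
  simp only [h2]
  generalize η p * ∑ c, ∑ d, (θ p c k * θ p d l) • frameCurvature ν Dν τ c d p = Y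
  simp only [Matrix.mul_apply, Matrix.transpose_apply, Finset.sum_mul]
  rw [Finset.sum_comm]
  exact Finset.sum_congr rfl fun i _ => Finset.sum_congr rfl fun j _ => by ring

end IsMovingFrame

/-! ### Dimension four: the Weyl tensor of an Einstein metric in a frame. -/

section Four

variable {g : Tensor2 4} {S : Set (Fin 4 → ℝ)} {θ E η : Tensor2 4}
    {ν : Fin 4 → Tensor2 4} {Dν : Fin 4 → Fin 4 → Tensor2 4}
    {τ : (Fin 4 → ℝ) → Fin 4 → Fin 4 → Fin 4 → ℝ} {p : Fin 4 → ℝ}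

/-- The components of a complex vector in a real frame with coframe `θ`. -/
def frameComponents (θ : Tensor2 4) (p : Fin 4 → ℝ) (v : Fin 4 → ℂ) : Fin 4 → ℂ :=
  (θ p).map (fun x => (x : ℂ)) *ᵥ v

theorem IsMovingFrame.metricC_eq (h : IsMovingFrame g S θ E η ν Dν τ) (hp : p ∈ S)
    (v w : Fin 4 → ℂ) : metricC g p v w
      = ∑ a, ∑ b, (η p a b : ℂ) * frameComponents θ p v a * frameComponents θ p w b := by
  have h1 : ∀ i j, (g p i j : ℂ) = ∑ a, ∑ b, (θ p).map (fun x => (x : ℂ)) a i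
      * (θ p).map (fun x => (x : ℂ)) b j * (η p).map (fun x => (x : ℂ)) a b := fun i j => by
    rw [h.metric_eq p hp]
    simp only [Matrix.mul_apply, Matrix.transpose_apply, Finset.sum_mul, Matrix.map_apply]
    rw [Finset.sum_comm]
    push_cast
    exact Finset.sum_congr rfl fun i _ => Finset.sum_congr rfl fun j _ => by ring
  simp only [metricC, h1]
  rw [sum_congruence_contract]
  rfl

/-- The scalar curvature is 4Λ, so the Ricci part contributes -Λ and the scalar part 2Λ/3 to the
coefficient of g ∧ g. -/
theorem weyl_of_einstein {Λ : ℝ} (hsymm : (g p).IsSymm) (hdet : IsUnit (g p).det)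
    (hE : ricci g p = Λ • g p) (i j k l : Fin 4) :
    weyl g i j k l p = ∑ m, g p i m * riemann g m j k l p
      - Λ / 3 * (g p i k * g p j l - g p i l * g p j k) := by
  have hs : scalarCurvature g p = 4 * Λ := by
    have h1 : scalarCurvature g p = ∑ j, Λ * ((g p)⁻¹ * g p) j j := by
      simp only [scalarCurvature, hE, Matrix.mul_apply, Finset.mul_sum, Matrix.smul_apply,
        smul_eq_mul]
      refine Finset.sum_congr rfl fun j _ => Finset.sum_congr rfl fun l _ => ?_
      rw [hsymm.apply j l]
      ring
    rw [h1, Matrix.nonsing_inv_mul _ hdet]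
    simp
  simp only [weyl, hs, hE, Matrix.smul_apply, smul_eq_mul]
  ring

/-- The Riemann part is moved to the frame two slots at a time. The remaining part involves only
products of the metric, which are left as `metricC` so that null-tetrad relations apply directly. -/
theorem IsMovingFrame.weylC_eq (h : IsMovingFrame g S θ E η ν Dν τ) (hp : p ∈ S) {Λ : ℝ}
    (hE : ricci g p = Λ • g p) (v w x y : Fin 4 → ℂ) :
    weylC g p v w x y = ∑ a, ∑ b, (∑ c, ∑ d, ((η p * frameCurvature ν Dν τ c d p) a b : ℂ)
        * frameComponents θ p x c * frameComponents θ p y d)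
        * frameComponents θ p v a * frameComponents θ p w b
      - Λ / 3 * (metricC g p v x * metricC g p w y - metricC g p v y * metricC g p w x) := by
  have hsymm : (g p).IsSymm := by
    rw [h.metric_eq p hp]
    unfold Matrix.IsSymm
    simp [Matrix.mul_assoc, (h.metric_symm p hp).eq]
  have hdet : IsUnit (g p).det := by
    rw [h.metric_eq p hp, Matrix.det_mul, Matrix.det_mul, Matrix.det_transpose]
    have : IsUnit (θ p).det :=
      Matrix.isUnit_det_of_left_inverse (h.frame_mul_coframe p hp)
    exact (this.mul (h.metric_det p hp)).mul this
  set Θ : Matrix (Fin 4) (Fin 4) ℂ := (θ p).map (fun x => (x : ℂ)) with hΘ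
  have h1 : ∀ i j k l, ((∑ m, g p i m * riemann g m j k l p : ℝ) : ℂ)
      = ∑ c, ∑ d, Θ c k * Θ d l * ∑ a, ∑ b, Θ a i * Θ b j
        * ((η p * frameCurvature ν Dν τ c d p) a b : ℂ) := fun i j k l => by
    rw [h.lowered_riemann_eq hp]
    push_cast
    simp only [Finset.mul_sum]
    rw [sum_comm_pairs]
    refine Finset.sum_congr rfl fun c _ => Finset.sum_congr rfl fun d _ =>
      Finset.sum_congr rfl fun a _ => Finset.sum_congr rfl fun b _ => ?_
    simp only [hΘ, Matrix.map_apply]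
    ring
  have h2 : ∑ i, ∑ j, ∑ k, ∑ l, ((∑ m, g p i m * riemann g m j k l p : ℝ) : ℂ)
        * v i * w j * x k * y l
      = ∑ a, ∑ b, (∑ c, ∑ d, ((η p * frameCurvature ν Dν τ c d p) a b : ℂ)
        * frameComponents θ p x c * frameComponents θ p y d)
        * frameComponents θ p v a * frameComponents θ p w b := by
    have h3 := sum_congruence_contract Θ (Matrix.of fun a b => ∑ c, ∑ d,
      ((η p * frameCurvature ν Dν τ c d p) a b : ℂ) * (Θ *ᵥ x) c * (Θ *ᵥ y) d) v w
    simp only [Matrix.of_apply] at h3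
    simp only [frameComponents]
    rw [← h3]
    refine Finset.sum_congr rfl fun i _ => Finset.sum_congr rfl fun j _ => ?_
    have h4 := sum_congruence_contract Θ (Matrix.of fun c d => ∑ a, ∑ b, Θ a i * Θ b j
        * ((η p * frameCurvature ν Dν τ c d p) a b : ℂ)) x y
    simp only [Matrix.of_apply] at h4
    calc _ = (∑ k, ∑ l, ((∑ m, g p i m * riemann g m j k l p : ℝ) : ℂ) * x k * y l)
          * v i * w j := by
          simp only [Finset.sum_mul]
          exact Finset.sum_congr rfl fun k _ => Finset.sum_congr rfl fun l _ => by ring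
      _ = _ := by
          simp only [h1]
          rw [h4]
          congr 2
          simp only [Finset.mul_sum, Finset.sum_mul]
          rw [sum_comm_pairs]
          exact Finset.sum_congr rfl fun a _ => Finset.sum_congr rfl fun b _ =>
            Finset.sum_congr rfl fun c _ => Finset.sum_congr rfl fun d _ => by ring
  have h5 : ∑ i, ∑ j, ∑ k, ∑ l, ((g p i k : ℂ) * g p j l - g p i l * g p j k)
        * v i * w j * x k * y l
      = metricC g p v x * metricC g p w y - metricC g p v y * metricC g p w x := by
    simp only [metricC, Fin.sum_univ_four]
    ring
  rw [← h2, ← h5, Finset.mul_sum, ← Finset.sum_sub_distrib]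
  refine Finset.sum_congr rfl fun i _ => ?_
  rw [Finset.mul_sum, ← Finset.sum_sub_distrib]
  refine Finset.sum_congr rfl fun j _ => ?_
  rw [Finset.mul_sum, ← Finset.sum_sub_distrib]
  refine Finset.sum_congr rfl fun k _ => ?_
  rw [Finset.mul_sum, ← Finset.sum_sub_distrib]
  refine Finset.sum_congr rfl fun l _ => ?_
  rw [weyl_of_einstein hsymm hdet hE]
  push_cast
  ring

end Four
end FrameTensors

/-! ### The frame data of the Taub-NUT lift -/

/-- The profile `(1 + t²) H / (2 F_{z z̄})` of the lift as a function of `t = tan (r/2)`. -/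
def profile (b t : ℝ) : ℝ := b * (1 + t ^ 2) + t / (1 + t ^ 2)

/-- The first derivative of `profile`. -/
def profile₁ (b t : ℝ) : ℝ := 2 * b * t + (1 - t ^ 2) / (1 + t ^ 2) ^ 2

/-- The second derivative of `profile`. -/
def profile₂ (b t : ℝ) : ℝ := 2 * b + (2 * t ^ 3 - 6 * t) / (1 + t ^ 2) ^ 3

/-- The matrix of the metric in the coframe `dx, dy, λ', dt`. -/
def frameMetric (Q b f t : ℝ) : Matrix (Fin 4) (Fin 4) ℝ :=
  !![2 * Q * f * (1 + t ^ 2), 0, 0, 0;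
     0, 2 * Q * f * (1 + t ^ 2), 0, 0;
     0, 0, Q * profile b t, Q;
     0, 0, Q, 0]

/-- The connection matrices of the coframe `dx, dy, λ', dt`; here `α, β` are the partial
derivatives of `log f`. -/
def frameConnection (b f α β t : ℝ) : Fin 4 → Matrix (Fin 4) (Fin 4) ℝ :=
  ![!![α / 2, β / 2, 0, t / (1 + t ^ 2);
       -(β / 2), α / 2, profile b t / (1 + t ^ 2), 1 / (1 + t ^ 2);
       -(2 * f * t), -(2 * f), 0, 0;
       2 * f * (t * profile b t), 0, 0, 0],
    !![β / 2, -(α / 2), -(profile b t / (1 + t ^ 2)), -(1 / (1 + t ^ 2));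
       α / 2, β / 2, 0, t / (1 + t ^ 2);
       2 * f, -(2 * f * t), 0, 0;
       0, 2 * f * (t * profile b t), 0, 0],
    !![0, -(profile b t / (1 + t ^ 2)), 0, 0;
       profile b t / (1 + t ^ 2), 0, 0, 0;
       0, 0, -(profile₁ b t / 2), 0;
       0, 0, profile b t * profile₁ b t / 2, profile₁ b t / 2],
    !![t / (1 + t ^ 2), -(1 / (1 + t ^ 2)), 0, 0;
       1 / (1 + t ^ 2), t / (1 + t ^ 2), 0, 0;
       0, 0, 0, 0;
       0, 0, profile₁ b t / 2, 0]]

/-- The derivatives of `frameConnection` along a vector of the base with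
`df = f₁, dα = α₁, dβ = β₁`. -/
def frameConnectionBase (b f₁ α₁ β₁ t : ℝ) : Fin 4 → Matrix (Fin 4) (Fin 4) ℝ :=
  ![!![α₁ / 2, β₁ / 2, 0, 0;
       -(β₁ / 2), α₁ / 2, 0, 0;
       -(2 * f₁ * t), -(2 * f₁), 0, 0;
       2 * f₁ * (t * profile b t), 0, 0, 0],
    !![β₁ / 2, -(α₁ / 2), 0, 0;
       α₁ / 2, β₁ / 2, 0, 0;
       2 * f₁, -(2 * f₁ * t), 0, 0;
       0, 2 * f₁ * (t * profile b t), 0, 0],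
    0, 0]

/-- The derivative of `profile b t / (1 + t²)`. -/
def profileQuot (b t : ℝ) : ℝ :=
  (profile₁ b t * (1 + t ^ 2) - profile b t * (2 * t)) / (1 + t ^ 2) ^ 2

/-- The derivatives of `frameConnection` with respect to `t`. -/
def frameConnectionFiber (b f t : ℝ) : Fin 4 → Matrix (Fin 4) (Fin 4) ℝ :=
  ![!![0, 0, 0, (1 - t ^ 2) / (1 + t ^ 2) ^ 2;
       0, 0, profileQuot b t, -(2 * t) / (1 + t ^ 2) ^ 2;
       -(2 * f), 0, 0, 0;
       2 * f * (profile b t + t * profile₁ b t), 0, 0, 0],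
    !![0, 0, -profileQuot b t, -(-(2 * t) / (1 + t ^ 2) ^ 2);
       0, 0, 0, (1 - t ^ 2) / (1 + t ^ 2) ^ 2;
       0, -(2 * f), 0, 0;
       0, 2 * f * (profile b t + t * profile₁ b t), 0, 0],
    !![0, -profileQuot b t, 0, 0;
       profileQuot b t, 0, 0, 0;
       0, 0, -(profile₂ b t / 2), 0;
       0, 0, (profile₁ b t * profile₁ b t + profile b t * profile₂ b t) / 2, profile₂ b t / 2],
    !![(1 - t ^ 2) / (1 + t ^ 2) ^ 2, -(-(2 * t) / (1 + t ^ 2) ^ 2), 0, 0;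
       -(2 * t) / (1 + t ^ 2) ^ 2, (1 - t ^ 2) / (1 + t ^ 2) ^ 2, 0, 0;
       0, 0, 0, 0;
       0, 0, profile₂ b t / 2, 0]]

/-- The derivatives of the connection matrices along the frame vectors. -/
def frameConnectionDeriv (b f α β αx αy βy t : ℝ) : Fin 4 → Fin 4 → Matrix (Fin 4) (Fin 4) ℝ :=
  ![frameConnectionBase b (f * α) αx αy t, frameConnectionBase b (f * β) αy βy t, 0,
    frameConnectionFiber b f t]

/-- The structure functions of the coframe: `dλ' = 4 f dx ∧ dy`. -/
def frameTorsion (f : ℝ) : Fin 4 → Fin 4 → Fin 4 → ℝ :=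
  ![![![0, 0, 0, 0], ![0, 0, 4 * f, 0], ![0, 0, 0, 0], ![0, 0, 0, 0]],
    ![![0, 0, -(4 * f), 0], ![0, 0, 0, 0], ![0, 0, 0, 0], ![0, 0, 0, 0]],
    ![![0, 0, 0, 0], ![0, 0, 0, 0], ![0, 0, 0, 0], ![0, 0, 0, 0]],
    ![![0, 0, 0, 0], ![0, 0, 0, 0], ![0, 0, 0, 0], ![0, 0, 0, 0]]]

/-- The derivatives of `frameMetric` along the frame vectors. -/
def frameMetricDeriv (Q b f α β t : ℝ) : Fin 4 → Matrix (Fin 4) (Fin 4) ℝ :=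
  ![!![2 * Q * (f * α) * (1 + t ^ 2), 0, 0, 0; 0, 2 * Q * (f * α) * (1 + t ^ 2), 0, 0;
       0, 0, 0, 0; 0, 0, 0, 0],
    !![2 * Q * (f * β) * (1 + t ^ 2), 0, 0, 0; 0, 2 * Q * (f * β) * (1 + t ^ 2), 0, 0;
       0, 0, 0, 0; 0, 0, 0, 0],
    0,
    !![2 * Q * f * (2 * t), 0, 0, 0; 0, 2 * Q * f * (2 * t), 0, 0;
       0, 0, Q * profile₁ b t, 0; 0, 0, 0, 0]]

/-! ### Pointwise identities for the connection and curvature matrices. -/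

theorem forall_fin_four {P : Fin 4 → Prop} : (∀ i, P i) ↔ P 0 ∧ P 1 ∧ P 2 ∧ P 3 := by
  simp only [Fin.forall_fin_succ, Fin.forall_fin_zero, and_true]
  rfl

/-- With `frameConnection_compatible` this certifies the matrices as the Levi-Civita connection.
Both identities treat the profile and its derivative as symbols and hold for any B(t). -/
theorem frameConnection_torsion (b f α β t : ℝ) : ∀ c d e : Fin 4,
    frameConnection b f α β t c e d - frameConnection b f α β t d e c
      = -frameTorsion f c d e := by
  simp only [forall_fin_four, frameConnection, frameTorsion, Matrix.of_apply, Matrix.cons_val,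
    true_and, and_true, sub_self, neg_zero]
  constructor <;> ring

theorem frameConnection_compatible (Q b f α β t : ℝ) : ∀ c : Fin 4,
    frameMetricDeriv Q b f α β t c = (frameConnection b f α β t c)ᵀ * frameMetric Q b f t
      + frameMetric Q b f t * frameConnection b f α β t c := by
  have hT : (1 + t ^ 2) ≠ 0 := by positivity
  simp only [← Matrix.ext_iff, Matrix.add_apply, Matrix.mul_apply, Matrix.transpose_apply,
    Fin.sum_univ_four, forall_fin_four, frameConnection, frameMetric, frameMetricDeriv,
    Matrix.of_apply, Matrix.cons_val, mul_zero, zero_mul, add_zero, zero_add, Matrix.zero_apply,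
    mul_neg, neg_mul, true_and, and_true]
  refine ⟨?_, ?_, ?_, ?_⟩
  all_goals
    field_simp
    and_intros <;> ring

/-- The curvature of the frame at a point. -/
def pointCurvature (b f α β αx αy βy t : ℝ) (c d : Fin 4) : Matrix (Fin 4) (Fin 4) ℝ :=
  frameConnectionDeriv b f α β αx αy βy t c d - frameConnectionDeriv b f α β αx αy βy t d c
    + frameConnection b f α β t c * frameConnection b f α β t d
    - frameConnection b f α β t d * frameConnection b f α β t c
    + ∑ e, frameTorsion f c d e • frameConnection b f α β t e

theorem pointCurvature_apply (b f α β αx αy βy t : ℝ) (c d i j : Fin 4) :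
    pointCurvature b f α β αx αy βy t c d i j
      = frameConnectionDeriv b f α β αx αy βy t c d i j
        - frameConnectionDeriv b f α β αx αy βy t d c i j
        + ∑ k, (frameConnection b f α β t c i k * frameConnection b f α β t d k j
          - frameConnection b f α β t d i k * frameConnection b f α β t c k j)
        + ∑ e, frameTorsion f c d e * frameConnection b f α β t e i j := by
  simp only [pointCurvature, Matrix.add_apply, Matrix.sub_apply, Matrix.mul_apply,
    Matrix.sum_apply, Matrix.smul_apply, smul_eq_mul, Finset.sum_sub_distrib]
  ring

/-- Three kinds of entries carry content: the base directions need the Kähler-Einstein equation,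
`e1` and `hb`; the λ'λ' and λ't entries need `e2` and `hb`. All others vanish identically. -/
theorem pointCurvature_ricci {Q b f α β αx αy βy t Λ : ℝ}
    (hb : Λ * Q = 3 * b) (hKE : αx + βy = -(16 * b * f)) : ∀ i j : Fin 4,
    ∑ a, pointCurvature b f α β αx αy βy t a j a i = Λ * frameMetric Q b f t i j := by
  have hT : (1 + t ^ 2) ≠ 0 := by positivity
  -- The two ODEs that determine the fibre profile. Both the b (1 + t²) part and the t/(1 + t²) part
  -- are needed here only through them.
  have e1 : 2 * profile b t * (1 + t ^ 2)⁻¹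
      = profile b t + t * profile₁ b t - 3 * b * (1 + t ^ 2) + 4 * b := by
    rw [profile, profile₁]
    field_simp
    ring
  have e2 : profile b t * (1 + t ^ 2)⁻¹ ^ 2 * 2 + t * (1 + t ^ 2)⁻¹ * profile₁ b t
      + profile₂ b t * (1 / 2) = 3 * b := by
    rw [profile, profile₁, profile₂]
    field_simp
    ring
  simp only [forall_fin_four, pointCurvature_apply, frameMetric, frameConnection,
    frameConnectionDeriv, frameConnectionBase, frameConnectionFiber, frameTorsion,
    Fin.sum_univ_four, Matrix.of_apply, Matrix.cons_val, mul_zero, zero_mul, add_zero, zero_add,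
    sub_zero, zero_sub, sub_self, neg_zero, mul_neg, neg_mul, Pi.zero_apply, Matrix.zero_apply,
    profileQuot]
  refine ⟨⟨?_, ?_, ?_, ?_⟩, ⟨?_, ?_, ?_, ?_⟩, ⟨?_, ?_, ?_, ?_⟩, ⟨?_, ?_, ?_, ?_⟩⟩
  all_goals first
    | ring1
    | linear_combination (-1 / 2) * hKE - 2 * f * e1 - 2 * f * (1 + t ^ 2) * hb
    | linear_combination profile b t * e2 - profile b t * hb
    | linear_combination e2 - hb
    | (field_simp; ring1)

/-- The lowered curvature of the frame at a point. -/
def pointRiemann (Q b f α β αx αy βy t : ℝ) (i j k l : Fin 4) : ℝ :=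
  (frameMetric Q b f t * pointCurvature b f α β αx αy βy t k l) i j

/-- The part of the curvature of the frame that is seen by a null tetrad adapted to
the frame. -/
theorem pointRiemann_eq (Q b f α β αx αy βy t : ℝ) :
    let R := pointRiemann Q b f α β αx αy βy t
    let r := Q * f * (t * profile₁ b t + 2 * (profile b t * (1 + t ^ 2)⁻¹))
    let s := Q * f * (profile₁ b t - 2 * (t * (profile b t * (1 + t ^ 2)⁻¹)))
    (R 3 0 3 0 = 0 ∧ R 3 0 3 1 = 0 ∧ R 3 1 3 0 = 0 ∧ R 3 1 3 1 = 0) ∧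
    (R 3 0 2 0 = r ∧ R 3 0 2 1 = -s ∧ R 3 1 2 0 = s ∧ R 3 1 2 1 = r) ∧
    (R 2 0 3 0 = r ∧ R 2 0 3 1 = s ∧ R 2 1 3 0 = -s ∧ R 2 1 3 1 = r) ∧
    (R 2 0 2 0 = profile b t * r ∧ R 2 0 2 1 = 0 ∧ R 2 1 2 0 = 0 ∧
      R 2 1 2 1 = profile b t * r) ∧
    (R 2 3 3 0 = 0 ∧ R 2 3 3 1 = 0 ∧ R 2 3 2 0 = 0 ∧ R 2 3 2 1 = 0) ∧
    (R 3 3 3 0 = 0 ∧ R 3 3 3 1 = 0 ∧ R 3 3 2 0 = 0 ∧ R 3 3 2 1 = 0) ∧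
    -- For k = E₃, l proportional to E₂ - (B/2) E₃ and m proportional to E₀ + i E₁, these blocks
    -- give all five Weyl scalars; Ψ₂ is 2(r + i s), normalised, minus Λ/3.
    R 3 2 3 0 = 0 ∧ R 3 2 3 1 = 0 := by
  have hT : (1 + t ^ 2) ≠ 0 := by positivity
  intro R r s
  simp only [R, r, s, pointRiemann, Matrix.mul_apply,
    pointCurvature_apply, frameMetric, frameConnection,
    frameConnectionDeriv, frameConnectionBase, frameConnectionFiber, frameTorsion,
    Fin.sum_univ_four, Matrix.of_apply, Matrix.cons_val, mul_zero, zero_mul, add_zero, zero_add,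
    sub_zero, zero_sub, sub_self, neg_zero, mul_neg, neg_mul, Pi.zero_apply, Matrix.zero_apply,
    profileQuot]
  refine ⟨⟨?_, ?_, ?_, ?_⟩, ⟨?_, ?_, ?_, ?_⟩, ⟨?_, ?_, ?_, ?_⟩, ⟨?_, ?_, ?_, ?_⟩,
    ⟨?_, ?_, ?_, ?_⟩, ⟨?_, ?_, ?_, ?_⟩, ?_, ?_⟩
  all_goals first
    | trivial
    | ring1
    | (field_simp; ring1)

/-! ### The Kähler base -/

section Base

theorem contDiffOn_fderiv_apply {E : Type*} [NormedAddCommGroup E] [NormedSpace ℝ E]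
    {U : Set E} (hU : IsOpen U) {f : E → ℝ} (hf : ContDiffOn ℝ ∞ f U) (v : E) :
    ContDiffOn ℝ ∞ (fun z => fderiv ℝ f z v) U :=
  (hf.fderiv_of_isOpen hU (by simp)).clm_apply contDiffOn_const

theorem differentiableAt_of_smoothOn {E : Type*} [NormedAddCommGroup E] [NormedSpace ℝ E]
    {U : Set E} (hU : IsOpen U) {f : E → ℝ} (hf : ContDiffOn ℝ ∞ f U) {z : E} (hz : z ∈ U) :
    DifferentiableAt ℝ f z :=
  (hf.contDiffAt (hU.mem_nhds hz)).differentiableAt (by simp)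

/-- The coordinate `z` as a continuous linear map. -/
def zCLM (n : ℕ) : (Fin (n + 2) → ℝ) →L[ℝ] ℂ :=
  LinearMap.toContinuousLinearMap
    { toFun := fun v => zOf v
      map_add' := fun v w => by apply Complex.ext <;> simp [zOf]
      map_smul' := fun c v => by apply Complex.ext <;> simp [zOf] }

theorem differentiableAt_comp_zOf {n : ℕ} {φ : ℂ → ℝ} {p : Fin (n + 2) → ℝ}
    (h : DifferentiableAt ℝ φ (zOf p)) : DifferentiableAt ℝ (fun x => φ (zOf x)) p :=
  DifferentiableAt.comp (g := φ) p h (zCLM n).differentiableAt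

theorem pd_comp_zOf {n : ℕ} {φ : ℂ → ℝ} {p : Fin (n + 2) → ℝ}
    (h : DifferentiableAt ℝ φ (zOf p)) (i : Fin (n + 2)) :
    pd i (fun x => φ (zOf x)) p = fderiv ℝ φ (zOf p) (zOf (Pi.single i 1)) := by
  have h1 : HasFDerivAt (fun x => φ (zOf x)) ((fderiv ℝ φ (zOf p)).comp (zCLM n)) p :=
    HasFDerivAt.comp (g := φ) p h.hasFDerivAt (zCLM n).hasFDerivAt
  rw [pd, h1.fderiv]
  rfl

theorem zOf_single_zero (n : ℕ) : zOf (Pi.single 0 1 : Fin (n + 2) → ℝ) = 1 := by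
  apply Complex.ext <;> simp [zOf]

theorem zOf_single_one (n : ℕ) : zOf (Pi.single 1 1 : Fin (n + 2) → ℝ) = Complex.I := by
  apply Complex.ext <;> simp [zOf]

theorem zOf_single_of_ne {n : ℕ} {i : Fin (n + 2)} (h0 : i ≠ 0) (h1 : i ≠ 1) :
    zOf (Pi.single i 1 : Fin (n + 2) → ℝ) = 0 := by
  apply Complex.ext <;> simp [zOf, h0.symm, h1.symm]

theorem contDiffOn_mixed {U : Set ℂ} (hU : IsOpen U) {F : ℂ → ℝ} (hF : ContDiffOn ℝ ∞ F U) :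
    ContDiffOn ℝ ∞ (mixed F) U := by
  have h1 : ∀ e : ℂ, ContDiffOn ℝ ∞ (fun z => fderiv ℝ (fun w => fderiv ℝ F w e) z e) U :=
    fun e => contDiffOn_fderiv_apply hU (contDiffOn_fderiv_apply hU hF e) e
  exact (((h1 1).add (h1 Complex.I)).div_const 4).congr fun z hz => mixed_eq hU hF hz

/-- The derivative of the logarithm of `F_{z z̄}` along `e`. -/
def logDeriv (F : ℂ → ℝ) (e z : ℂ) : ℝ :=
  fderiv ℝ (fun w => Real.log (mixed F w)) z e

variable {U : Set ℂ} {F : ℂ → ℝ}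

theorem contDiffOn_log_mixed (hU : IsOpen U) (hF : ContDiffOn ℝ ∞ F U)
    (hpos : ∀ z ∈ U, 0 < mixed F z) :
    ContDiffOn ℝ ∞ (fun w => Real.log (mixed F w)) U :=
  (contDiffOn_mixed hU hF).log fun z hz => (hpos z hz).ne'

theorem contDiffOn_logDeriv (hU : IsOpen U) (hF : ContDiffOn ℝ ∞ F U)
    (hpos : ∀ z ∈ U, 0 < mixed F z) (e : ℂ) : ContDiffOn ℝ ∞ (logDeriv F e) U :=
  contDiffOn_fderiv_apply hU (contDiffOn_log_mixed hU hF hpos) e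

theorem fderiv_mixed (hU : IsOpen U) (hF : ContDiffOn ℝ ∞ F U)
    (hpos : ∀ z ∈ U, 0 < mixed F z) {z : ℂ} (hz : z ∈ U) (e : ℂ) :
    fderiv ℝ (mixed F) z e = mixed F z * logDeriv F e z := by
  have h1 := (differentiableAt_of_smoothOn hU (contDiffOn_mixed hU hF) hz).hasFDerivAt.log
    (hpos z hz).ne'
  have := (hpos z hz).ne'
  rw [logDeriv, h1.fderiv]
  simp [this]

theorem fderiv_logDeriv_comm (hU : IsOpen U) (hF : ContDiffOn ℝ ∞ F U)
    (hpos : ∀ z ∈ U, 0 < mixed F z) {z : ℂ} (hz : z ∈ U) (v w : ℂ) :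
    fderiv ℝ (logDeriv F v) z w = fderiv ℝ (logDeriv F w) z v :=
  fderiv_fderiv_comm ((contDiffOn_log_mixed hU hF hpos).contDiffAt (hU.mem_nhds hz)) v w

/-- The connection matrices of the Kähler metric. -/
def kahlerConnection (F : ℂ → ℝ) : Fin 2 → Tensor2 2 := fun c x =>
  (logDeriv F 1 (zOf x) / 2) • (![1, !![0, -1; 1, 0]] : Fin 2 → Matrix (Fin 2) (Fin 2) ℝ) c
    + (logDeriv F Complex.I (zOf x) / 2)
      • (![!![0, 1; -1, 0], 1] : Fin 2 → Matrix (Fin 2) (Fin 2) ℝ) c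

/-- The coordinate frame itself serves as the moving frame, with no structure functions, so that the
base and the lift share one curvature formula. -/
theorem isMovingFrame_kahlerMetric (hU : IsOpen U) (hF : ContDiffOn ℝ ∞ F U)
    (hpos : ∀ z ∈ U, 0 < mixed F z) :
    IsMovingFrame (kahlerMetric F) {v | zOf v ∈ U} (fun _ => 1) (fun _ => 1) (kahlerMetric F)
      (kahlerConnection F) (fun c d => pdM c (kahlerConnection F d)) (fun _ _ _ _ => 0) := by
  have hdf : ∀ p : Fin 2 → ℝ, zOf p ∈ U → DifferentiableAt ℝ (fun x => mixed F (zOf x)) p :=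
    fun p hp => differentiableAt_comp_zOf (differentiableAt_of_smoothOn hU
      (contDiffOn_mixed hU hF) hp)
  have hdl : ∀ (e : ℂ) (p : Fin 2 → ℝ), zOf p ∈ U →
      DifferentiableAt ℝ (fun x => logDeriv F e (zOf x)) p :=
    fun e p hp => differentiableAt_comp_zOf (differentiableAt_of_smoothOn hU
      (contDiffOn_logDeriv hU hF hpos e) hp)
  have hs : ∀ (k : Fin 2) (A : Fin 2 → Matrix (Fin 2) (Fin 2) ℝ),
      ∑ c, (1 : Matrix (Fin 2) (Fin 2) ℝ) c k • A c = A k := fun k A => by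
    simp [Matrix.one_apply]
  refine ⟨hU.preimage (zCLM 0).continuous, fun a b => contDiffOn_const,
    fun a b => contDiffOn_const, fun p _ => one_mul 1, fun p _ => by simp, fun p _ => ?_,
    fun p hp => ?_, fun p hp a b => ?_, fun p hp c a b => ?_, fun p _ e k l => ?_,
    fun p hp k => ?_, fun p _ c d e => ?_, fun p _ d k =>
      (hs k fun c => pdM c (kahlerConnection F d) p).symm⟩
  · simp [Matrix.IsSymm, kahlerMetric]
  · have := (hpos _ hp).ne'
    simp [kahlerMetric, this]
  · simp only [kahlerMetric, Matrix.smul_apply, smul_eq_mul]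
    exact ((hdf p hp).const_mul 2).mul_const _
  · simp only [kahlerConnection, Matrix.add_apply, Matrix.smul_apply, smul_eq_mul]
    simp only [div_eq_mul_inv]
    exact (((hdl _ p hp).mul_const _).mul_const _).add (((hdl _ p hp).mul_const _).mul_const _)
  · simp [pd_const]
  · rw [hs k]
    have h1 : ∀ a b, pdM k (kahlerMetric F) p a b = 2 * (mixed F (zOf p)
        * logDeriv F (zOf (Pi.single k 1)) (zOf p)) * (1 : Matrix (Fin 2) (Fin 2) ℝ) a b := by
      intro a b
      have h2 := pd_mul (differentiableAt_const
        (2 * (1 : Matrix (Fin 2) (Fin 2) ℝ) a b)) (hdf p hp) k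
      rw [pd_const, pd_comp_zOf (differentiableAt_of_smoothOn hU (contDiffOn_mixed hU hF) hp),
        fderiv_mixed hU hF hpos hp] at h2
      simp only [pdM, kahlerMetric, Matrix.of_apply, Matrix.smul_apply, smul_eq_mul]
      have h3 : (fun x : Fin 2 → ℝ => 2 * mixed F (zOf x) * (1 : Matrix (Fin 2) (Fin 2) ℝ) a b)
          = fun x => 2 * (1 : Matrix (Fin 2) (Fin 2) ℝ) a b * mixed F (zOf x) := by
        funext x
        ring
      rw [h3, h2]
      ring
    ext a b
    rw [h1]
    fin_cases k <;> fin_cases a <;> fin_cases b <;>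
      simp [kahlerConnection, kahlerMetric, zOf_single_zero, zOf_single_one] <;> ring
  · fin_cases c <;> fin_cases d <;> fin_cases e <;> simp [kahlerConnection]

/-- The Einstein condition of the Kähler metric in terms of its potential. -/
theorem laplacian_log_mixed (hU : IsOpen U) (hF : ContDiffOn ℝ ∞ F U)
    (hpos : ∀ z ∈ U, 0 < mixed F z) {Λo : ℝ}
    (hKE : IsEinsteinOn (kahlerMetric F) {v | zOf v ∈ U} Λo) {z : ℂ} (hz : z ∈ U) :
    fderiv ℝ (logDeriv F 1) z 1 + fderiv ℝ (logDeriv F Complex.I) z Complex.I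
      = -(4 * Λo * mixed F z) := by
  obtain ⟨p, hpz⟩ : ∃ p : Fin 2 → ℝ, zOf p = z := ⟨![z.re, z.im], rfl⟩
  have hp : zOf p ∈ U := hpz ▸ hz
  have h1 := (isMovingFrame_kahlerMetric hU hF hpos).ricci_eq (p := p) hp
  rw [hKE p hp] at h1
  -- One diagonal entry suffices, since the metric is conformally flat of dimension two: it reads 2
  -- Λo f = -½ Δ log f.
  have h2 := congrFun (congrFun h1 0) 0
  have hda : ∀ e, DifferentiableAt ℝ (fun x : Fin 2 → ℝ => logDeriv F e (zOf x) / 2) p :=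
    fun e => by
      simpa only [div_eq_mul_inv] using (differentiableAt_comp_zOf (differentiableAt_of_smoothOn
        hU (contDiffOn_logDeriv hU hF hpos e) hp)).mul_const _
  have hd : ∀ (c d a b : Fin 2), pdM c (kahlerConnection F d) p a b
      = fderiv ℝ (logDeriv F 1) (zOf p) (zOf (Pi.single c 1)) / 2
        * (![1, !![0, -1; 1, 0]] : Fin 2 → Matrix (Fin 2) (Fin 2) ℝ) d a b
      + fderiv ℝ (logDeriv F Complex.I) (zOf p) (zOf (Pi.single c 1)) / 2
        * (![!![0, 1; -1, 0], 1] : Fin 2 → Matrix (Fin 2) (Fin 2) ℝ) d a b := by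
    intro c d a b
    have h3 : ∀ e (r : ℝ), pd c (fun x => logDeriv F e (zOf x) / 2 * r) p
        = fderiv ℝ (logDeriv F e) (zOf p) (zOf (Pi.single c 1)) / 2 * r := fun e r => by
      have h4 := pd_mul (differentiableAt_const (r / 2)) (differentiableAt_comp_zOf
        (differentiableAt_of_smoothOn hU (contDiffOn_logDeriv hU hF hpos e) hp)) c
      rw [pd_const, pd_comp_zOf (differentiableAt_of_smoothOn hU
        (contDiffOn_logDeriv hU hF hpos e) hp)] at h4
      have h5 : (fun x : Fin 2 → ℝ => logDeriv F e (zOf x) / 2 * r)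
          = fun x => r / 2 * logDeriv F e (zOf x) := by
        funext x
        ring
      rw [h5, h4]
      ring
    simp only [pdM, kahlerConnection, Matrix.of_apply, Matrix.add_apply, Matrix.smul_apply,
      smul_eq_mul]
    rw [pd_add ((hda _).mul_const _) ((hda _).mul_const _), h3, h3]
  rw [← hpz]
  simp [frameCurvature, hd, kahlerMetric, zOf_single_zero, zOf_single_one,
    Fin.sum_univ_two, Matrix.mul_apply, kahlerConnection] at h2
  linarith

theorem mixed_log_mixed (hU : IsOpen U) (hF : ContDiffOn ℝ ∞ F U)
    (hpos : ∀ z ∈ U, 0 < mixed F z) {Λo : ℝ}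
    (hKE : IsEinsteinOn (kahlerMetric F) {v | zOf v ∈ U} Λo) {z : ℂ} (hz : z ∈ U) :
    mixed (fun w => Real.log (mixed F w)) z = -(Λo * mixed F z) := by
  rw [mixed_eq hU (contDiffOn_log_mixed hU hF hpos) hz]
  have := laplacian_log_mixed hU hF hpos hKE hz
  unfold logDeriv at this
  linarith

theorem mixed_const (q : ℝ) (z : ℂ) : mixed (fun _ => q) z = 0 := by
  rw [mixed_eq isOpen_univ contDiffOn_const (Set.mem_univ z)]
  simp

/-- The derivative term vanishes, and the Einstein condition makes the coefficient of q equal to Λo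
f/4. Both sides are then multiples of f q, equal by `hq`. -/
theorem solvesLogisticOn_const (hU : IsOpen U) (hF : ContDiffOn ℝ ∞ F U)
    (hpos : ∀ z ∈ U, 0 < mixed F z) {Λo Λ q : ℝ}
    (hKE : IsEinsteinOn (kahlerMetric F) {v | zOf v ∈ U} Λo) (hq : Λ * q ^ 2 = 3 * (Λo / 4)) :
    SolvesLogisticOn F Λ U (fun _ => q) := by
  intro z hz
  rw [mixed_const, mixed_log_mixed hU hF hpos hKE hz]
  linear_combination (-(1 / 3) * mixed F z * q) * hq

end Base

/-! ### The moving frame of the lift -/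

section Lift

/-- The fibre coordinate `t = tan (r/2)`. -/
def tOf (p : Fin 4 → ℝ) : ℝ := Real.tan (p 3 / 2)

/-- The coframe `dx, dy, λ', dt`. -/
def liftCoframe (F : ℂ → ℝ) : Tensor2 4 := fun p =>
  !![1, 0, 0, 0;
     0, 1, 0, 0;
     -fderiv ℝ F (zOf p) Complex.I, fderiv ℝ F (zOf p) 1, 1, 0;
     0, 0, 0, (1 + tOf p ^ 2) / 2]

/-- The frame dual to `liftCoframe`. -/
def liftFrame (F : ℂ → ℝ) : Tensor2 4 := fun p =>
  !![1, 0, 0, 0;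
     0, 1, 0, 0;
     fderiv ℝ F (zOf p) Complex.I, -fderiv ℝ F (zOf p) 1, 1, 0;
     0, 0, 0, 2 / (1 + tOf p ^ 2)]

/-- The matrix of the lift in the frame `liftFrame`. -/
def liftFrameMetric (F : ℂ → ℝ) (Q b : ℝ) : Tensor2 4 := fun p =>
  frameMetric Q b (mixed F (zOf p)) (tOf p)

/-- The connection matrices of `liftFrame`. -/
def liftConnection (F : ℂ → ℝ) (b : ℝ) : Fin 4 → Tensor2 4 := fun c p =>
  frameConnection b (mixed F (zOf p)) (logDeriv F 1 (zOf p)) (logDeriv F Complex.I (zOf p))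
    (tOf p) c

/-- The derivatives of `liftConnection` along the vectors of `liftFrame`. -/
def liftConnectionDeriv (F : ℂ → ℝ) (b : ℝ) : Fin 4 → Fin 4 → Tensor2 4 := fun c d p =>
  frameConnectionDeriv b (mixed F (zOf p)) (logDeriv F 1 (zOf p)) (logDeriv F Complex.I (zOf p))
    (fderiv ℝ (logDeriv F 1) (zOf p) 1) (fderiv ℝ (logDeriv F 1) (zOf p) Complex.I)
    (fderiv ℝ (logDeriv F Complex.I) (zOf p) Complex.I) (tOf p) c d

/-- The function `H` of the lift. -/
def liftH (F : ℂ → ℝ) (b : ℝ) (p : Fin 4 → ℝ) : ℝ :=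
  2 * mixed F (zOf p) * (b + tOf p / (1 + tOf p ^ 2) ^ 2)

theorem isOpen_spacetime {U : Set ℂ} (hU : IsOpen U) : IsOpen (spacetime U) :=
  (hU.preimage (zCLM 2).continuous).inter
    (isOpen_ne_fun (f := fun p : Fin 4 → ℝ => Real.cos (p 3 / 2)) (by fun_prop) continuous_const)

theorem one_add_tOf_sq {p : Fin 4 → ℝ} (hc : Real.cos (p 3 / 2) ≠ 0) :
    1 + tOf p ^ 2 = 1 / Real.cos (p 3 / 2) ^ 2 := by
  have h1 := Real.sin_sq_add_cos_sq (p 3 / 2)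
  rw [tOf, Real.tan_eq_sin_div_cos]
  field_simp
  linarith

/-- `φ` has the derivatives `d₀, …, d₃` at `p` along the vectors of the frame dual to `θ`. -/
structure HasCoframeDeriv (θ : Tensor2 4) (φ : (Fin 4 → ℝ) → ℝ) (p : Fin 4 → ℝ)
    (d₀ d₁ d₂ d₃ : ℝ) : Prop where
  differentiableAt : DifferentiableAt ℝ φ p
  pd_eq : ∀ k, pd k φ p = θ p 0 k * d₀ + θ p 1 k * d₁ + θ p 2 k * d₂ + θ p 3 k * d₃

namespace HasCoframeDeriv

variable {θ : Tensor2 4} {φ ψ : (Fin 4 → ℝ) → ℝ} {p : Fin 4 → ℝ}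
    {d₀ d₁ d₂ d₃ e₀ e₁ e₂ e₃ : ℝ}

theorem zero : HasCoframeDeriv θ (fun _ => 0) p 0 0 0 0 :=
  ⟨differentiableAt_const _, fun k => by rw [pd_const]; ring⟩

theorem const (c : ℝ) : HasCoframeDeriv θ (fun _ => c) p 0 0 0 0 :=
  ⟨differentiableAt_const _, fun k => by rw [pd_const]; ring⟩

theorem mul (h : HasCoframeDeriv θ φ p d₀ d₁ d₂ d₃) (h' : HasCoframeDeriv θ ψ p e₀ e₁ e₂ e₃) :
    HasCoframeDeriv θ (fun x => φ x * ψ x) p (d₀ * ψ p + φ p * e₀) (d₁ * ψ p + φ p * e₁)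
      (d₂ * ψ p + φ p * e₂) (d₃ * ψ p + φ p * e₃) :=
  ⟨h.1.mul h'.1, fun k => by rw [pd_mul h.1 h'.1, h.2, h'.2]; ring⟩

theorem neg (h : HasCoframeDeriv θ φ p d₀ d₁ d₂ d₃) :
    HasCoframeDeriv θ (fun x => -φ x) p (-d₀) (-d₁) (-d₂) (-d₃) :=
  ⟨h.1.neg, fun k => by
    have h1 := h.2 k
    simp only [pd] at h1 ⊢
    rw [fderiv_fun_neg, neg_apply, h1]
    ring⟩

theorem congr (h : HasCoframeDeriv θ φ p d₀ d₁ d₂ d₃) (hφ : ∀ x, ψ x = φ x) (h₀ : e₀ = d₀)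
    (h₁ : e₁ = d₁) (h₂ : e₂ = d₂) (h₃ : e₃ = d₃) : HasCoframeDeriv θ ψ p e₀ e₁ e₂ e₃ := by
  rw [funext hφ, h₀, h₁, h₂, h₃]
  exact h

end HasCoframeDeriv

variable {U : Set ℂ} {F : ℂ → ℝ} {p : Fin 4 → ℝ}

theorem hasCoframeDeriv_base {φ : ℂ → ℝ} (h : DifferentiableAt ℝ φ (zOf p)) :
    HasCoframeDeriv (liftCoframe F) (fun x => φ (zOf x)) p (fderiv ℝ φ (zOf p) 1)
      (fderiv ℝ φ (zOf p) Complex.I) 0 0 := by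
  refine ⟨differentiableAt_comp_zOf h, ?_⟩
  have h2 : zOf (Pi.single 2 1 : Fin 4 → ℝ) = 0 := zOf_single_of_ne (by decide) (by decide)
  have h3 : zOf (Pi.single 3 1 : Fin 4 → ℝ) = 0 := zOf_single_of_ne (by decide) (by decide)
  simp only [pd_comp_zOf h, forall_fin_four, zOf_single_zero 2, zOf_single_one 2, h2, h3,
    liftCoframe, Matrix.of_apply, Matrix.cons_val, map_zero]
  refine ⟨?_, ?_, ?_, ?_⟩ <;> ring

theorem hasFDerivAt_tOf (hc : Real.cos (p 3 / 2) ≠ 0) :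
    HasFDerivAt tOf (((1 + tOf p ^ 2) / 2) • (ContinuousLinearMap.proj 3 : (Fin 4 → ℝ) →L[ℝ] ℝ))
      p := by
  have h1 : HasFDerivAt (fun x : Fin 4 → ℝ => x 3 / 2)
      ((1 / 2 : ℝ) • (ContinuousLinearMap.proj 3 : (Fin 4 → ℝ) →L[ℝ] ℝ)) p := by
    have h2 := (ContinuousLinearMap.proj (R := ℝ) (φ := fun _ : Fin 4 => ℝ)
      3).hasFDerivAt (x := p) |>.const_smul (1 / 2 : ℝ)
    refine h2.congr_of_eventuallyEq (Filter.Eventually.of_forall fun x => ?_)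
    simp
    ring
  have h3 := (Real.hasDerivAt_tan hc).comp_hasFDerivAt p h1
  rw [smul_smul, ← one_add_tOf_sq hc] at h3
  rw [div_eq_mul_one_div]
  exact h3

theorem hasCoframeDeriv_fiber {φ : ℝ → ℝ} {φ' : ℝ} (hc : Real.cos (p 3 / 2) ≠ 0)
    (h : HasDerivAt φ φ' (tOf p)) :
    HasCoframeDeriv (liftCoframe F) (fun x => φ (tOf x)) p 0 0 0 φ' := by
  have h1 := h.comp_hasFDerivAt p (hasFDerivAt_tOf hc)
  refine ⟨h1.differentiableAt, ?_⟩
  have h2 : ∀ k, pd k (fun x => φ (tOf x)) p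
      = φ' * ((1 + tOf p ^ 2) / 2 * (Pi.single k 1 : Fin 4 → ℝ) 3) := fun k => by
    have h3 : fderiv ℝ (fun x => φ (tOf x)) p = _ := h1.fderiv
    rw [pd, h3]
    simp
  simp only [h2, forall_fin_four, liftCoframe, Matrix.of_apply, Matrix.cons_val]
  refine ⟨?_, ?_, ?_, ?_⟩ <;> simp
  ring

theorem hasDerivAt_one_add_sq (t : ℝ) : HasDerivAt (fun t : ℝ => 1 + t ^ 2) (2 * t) t := by
  simpa using (hasDerivAt_pow 2 t).const_add 1

theorem hasDerivAt_div_one_add_sq (t : ℝ) :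
    HasDerivAt (fun t : ℝ => t / (1 + t ^ 2)) ((1 - t ^ 2) / (1 + t ^ 2) ^ 2) t := by
  have hT : (1 + t ^ 2) ≠ 0 := by positivity
  refine ((hasDerivAt_id t).div (hasDerivAt_one_add_sq t) hT).congr_deriv ?_
  simp only [id]
  ring

theorem hasDerivAt_inv_one_add_sq (t : ℝ) :
    HasDerivAt (fun t : ℝ => 1 / (1 + t ^ 2)) (-(2 * t) / (1 + t ^ 2) ^ 2) t := by
  have hT : (1 + t ^ 2) ≠ 0 := by positivity
  refine ((hasDerivAt_const t (1 : ℝ)).div (hasDerivAt_one_add_sq t) hT).congr_deriv ?_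
  ring

theorem hasDerivAt_profile (b t : ℝ) : HasDerivAt (profile b) (profile₁ b t) t := by
  refine (((hasDerivAt_one_add_sq t).const_mul b).add
    (hasDerivAt_div_one_add_sq t)).congr_deriv ?_
  rw [profile₁]
  ring

theorem hasDerivAt_profile₁ (b t : ℝ) : HasDerivAt (profile₁ b) (profile₂ b t) t := by
  have hT : (1 + t ^ 2) ≠ 0 := by positivity
  have h1 : HasDerivAt (fun t : ℝ => (1 + t ^ 2) ^ 2) (2 * (1 + t ^ 2) * (2 * t)) t := by
    simpa using (hasDerivAt_one_add_sq t).fun_pow 2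
  have h2 : HasDerivAt (fun t : ℝ => 1 - t ^ 2) (-(2 * t)) t := by
    simpa using (hasDerivAt_pow 2 t).const_sub 1
  refine (((hasDerivAt_id t).const_mul (2 * b)).add (h2.div h1 (pow_ne_zero 2 hT))).congr_deriv ?_
  rw [profile₂]
  field_simp
  ring

theorem hasDerivAt_profile_div (b t : ℝ) :
    HasDerivAt (fun t => profile b t / (1 + t ^ 2)) (profileQuot b t) t :=
  (hasDerivAt_profile b t).div (hasDerivAt_one_add_sq t) (by positivity)

/-- The 64 entries of the connection matrices are, up to sign, a handful of functions of the base
and of t. Each is differentiated once, and the entries are then matched syntactically. -/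
theorem liftConnection_hasCoframeDeriv (hU : IsOpen U) (hF : ContDiffOn ℝ ∞ F U)
    (hpos : ∀ z ∈ U, 0 < mixed F z) (b : ℝ) (hp : p ∈ spacetime U) : ∀ d i j,
    HasCoframeDeriv (liftCoframe F) (fun x => liftConnection F b d x i j) p
      (liftConnectionDeriv F b 0 d p i j) (liftConnectionDeriv F b 1 d p i j)
      (liftConnectionDeriv F b 2 d p i j) (liftConnectionDeriv F b 3 d p i j) := by
  obtain ⟨hz, hc⟩ := hp
  have hα : HasCoframeDeriv (liftCoframe F) (fun x => logDeriv F 1 (zOf x) / 2) p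
      (fderiv ℝ (logDeriv F 1) (zOf p) 1 / 2) (fderiv ℝ (logDeriv F 1) (zOf p) Complex.I / 2)
      0 0 :=
    ((hasCoframeDeriv_base (differentiableAt_of_smoothOn hU
      (contDiffOn_logDeriv hU hF hpos 1) hz)).mul (.const (1 / 2))).congr
      (fun _ => by ring) (by ring) (by ring) (by ring) (by ring)
  have hβ : HasCoframeDeriv (liftCoframe F) (fun x => logDeriv F Complex.I (zOf x) / 2) p
      (fderiv ℝ (logDeriv F 1) (zOf p) Complex.I / 2)
      (fderiv ℝ (logDeriv F Complex.I) (zOf p) Complex.I / 2) 0 0 := by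
    -- `frameConnectionDeriv` stores a single mixed second derivative of log f, so β_x has to be
    -- written as α_y.
    rw [fderiv_logDeriv_comm hU hF hpos hz 1]
    exact ((hasCoframeDeriv_base (differentiableAt_of_smoothOn hU
      (contDiffOn_logDeriv hU hF hpos Complex.I) hz)).mul (.const (1 / 2))).congr
      (fun _ => by ring) (by ring) (by ring) (by ring) (by ring)
  have hf : HasCoframeDeriv (liftCoframe F) (fun x => 2 * mixed F (zOf x)) p
      (2 * (mixed F (zOf p) * logDeriv F 1 (zOf p)))
      (2 * (mixed F (zOf p) * logDeriv F Complex.I (zOf p))) 0 0 := by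
    rw [← fderiv_mixed hU hF hpos hz, ← fderiv_mixed hU hF hpos hz]
    exact ((hasCoframeDeriv_base (differentiableAt_of_smoothOn hU
      (contDiffOn_mixed hU hF) hz)).mul (.const 2)).congr
      (fun _ => by ring) (by ring) (by ring) (by ring) (by ring)
  have ht : HasCoframeDeriv (liftCoframe F) tOf p 0 0 0 1 :=
    hasCoframeDeriv_fiber hc (hasDerivAt_id (tOf p))
  have hB : HasCoframeDeriv (liftCoframe F) (fun x => profile b (tOf x)) p 0 0 0
      (profile₁ b (tOf p)) := hasCoframeDeriv_fiber hc (hasDerivAt_profile b _)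
  have hB₁ : HasCoframeDeriv (liftCoframe F) (fun x => profile₁ b (tOf x)) p 0 0 0
      (profile₂ b (tOf p)) := hasCoframeDeriv_fiber hc (hasDerivAt_profile₁ b _)
  have hB₁' : HasCoframeDeriv (liftCoframe F) (fun x => profile₁ b (tOf x) / 2) p 0 0 0
      (profile₂ b (tOf p) / 2) := (hB₁.mul (.const (1 / 2))).congr
      (fun _ => by ring) (by ring) (by ring) (by ring) (by ring)
  have hBB : HasCoframeDeriv (liftCoframe F)
      (fun x => profile b (tOf x) * profile₁ b (tOf x) / 2) p 0 0 0
      ((profile₁ b (tOf p) * profile₁ b (tOf p) + profile b (tOf p) * profile₂ b (tOf p)) / 2) :=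
    (hB.mul hB₁').congr (fun _ => by ring) (by ring) (by ring) (by ring) (by ring)
  have ht' : HasCoframeDeriv (liftCoframe F) (fun x => tOf x / (1 + tOf x ^ 2)) p 0 0 0
      ((1 - tOf p ^ 2) / (1 + tOf p ^ 2) ^ 2) :=
    hasCoframeDeriv_fiber hc (hasDerivAt_div_one_add_sq _)
  have hi : HasCoframeDeriv (liftCoframe F) (fun x => 1 / (1 + tOf x ^ 2)) p 0 0 0
      (-(2 * tOf p) / (1 + tOf p ^ 2) ^ 2) :=
    hasCoframeDeriv_fiber hc (hasDerivAt_inv_one_add_sq _)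
  have hBi : HasCoframeDeriv (liftCoframe F) (fun x => profile b (tOf x) / (1 + tOf x ^ 2)) p
      0 0 0 (profileQuot b (tOf p)) :=
    hasCoframeDeriv_fiber hc (hasDerivAt_profile_div b _)
  have hft : HasCoframeDeriv (liftCoframe F) (fun x => 2 * mixed F (zOf x) * tOf x) p
      (2 * (mixed F (zOf p) * logDeriv F 1 (zOf p)) * tOf p)
      (2 * (mixed F (zOf p) * logDeriv F Complex.I (zOf p)) * tOf p) 0
      (2 * mixed F (zOf p)) :=
    (hf.mul ht).congr (fun _ => rfl) (by ring) (by ring) (by ring) (by ring)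
  have hftB : HasCoframeDeriv (liftCoframe F)
      (fun x => 2 * mixed F (zOf x) * (tOf x * profile b (tOf x))) p
      (2 * (mixed F (zOf p) * logDeriv F 1 (zOf p)) * (tOf p * profile b (tOf p)))
      (2 * (mixed F (zOf p) * logDeriv F Complex.I (zOf p)) * (tOf p * profile b (tOf p))) 0
      (2 * mixed F (zOf p) * (profile b (tOf p) + tOf p * profile₁ b (tOf p))) :=
    (hf.mul (ht.mul hB)).congr (fun _ => rfl) (by ring) (by ring) (by ring) (by ring)
  have hα' := hα.neg
  have hβ' := hβ.neg
  have hf' := hf.neg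
  have hft' := hft.neg
  have hi' := hi.neg
  have hBi' := hBi.neg
  have hB₁'' := hB₁'.neg
  -- Negation leaves -0 among the derivatives; it must become 0 for `assumption` to match.
  simp only [neg_zero] at hα' hβ' hf' hft' hi' hBi' hB₁''
  have h0 : HasCoframeDeriv (liftCoframe F) (fun _ => 0) p 0 0 0 0 := .zero
  simp only [forall_fin_four, liftConnection, liftConnectionDeriv, frameConnection,
    frameConnectionDeriv, frameConnectionBase, frameConnectionFiber, Matrix.of_apply,
    Matrix.cons_val, Pi.zero_apply, Matrix.zero_apply]
  and_intros <;> assumption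

theorem liftFrameMetric_hasCoframeDeriv (hU : IsOpen U) (hF : ContDiffOn ℝ ∞ F U)
    (hpos : ∀ z ∈ U, 0 < mixed F z) (Q b : ℝ) (hp : p ∈ spacetime U) :
    let D := frameMetricDeriv Q b (mixed F (zOf p)) (logDeriv F 1 (zOf p))
      (logDeriv F Complex.I (zOf p)) (tOf p)
    ∀ i j, HasCoframeDeriv (liftCoframe F) (fun x => liftFrameMetric F Q b x i j) p
      (D 0 i j) (D 1 i j) (D 2 i j) (D 3 i j) := by
  obtain ⟨hz, hc⟩ := hp
  have hf : HasCoframeDeriv (liftCoframe F) (fun x => mixed F (zOf x)) p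
      (mixed F (zOf p) * logDeriv F 1 (zOf p))
      (mixed F (zOf p) * logDeriv F Complex.I (zOf p)) 0 0 := by
    rw [← fderiv_mixed hU hF hpos hz, ← fderiv_mixed hU hF hpos hz]
    exact hasCoframeDeriv_base (differentiableAt_of_smoothOn hU (contDiffOn_mixed hU hF) hz)
  have hT : HasCoframeDeriv (liftCoframe F) (fun x => 1 + tOf x ^ 2) p 0 0 0 (2 * tOf p) :=
    hasCoframeDeriv_fiber hc (hasDerivAt_one_add_sq _)
  have hfT : HasCoframeDeriv (liftCoframe F) (fun x => 2 * Q * mixed F (zOf x) * (1 + tOf x ^ 2))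
      p (2 * Q * (mixed F (zOf p) * logDeriv F 1 (zOf p)) * (1 + tOf p ^ 2))
      (2 * Q * (mixed F (zOf p) * logDeriv F Complex.I (zOf p)) * (1 + tOf p ^ 2)) 0
      (2 * Q * mixed F (zOf p) * (2 * tOf p)) :=
    ((HasCoframeDeriv.const (2 * Q)).mul (hf.mul hT)).congr
      (fun _ => by ring) (by ring) (by ring) (by ring) (by ring)
  have hB : HasCoframeDeriv (liftCoframe F) (fun x => Q * profile b (tOf x)) p 0 0 0
      (Q * profile₁ b (tOf p)) :=
    ((HasCoframeDeriv.const Q).mul (hasCoframeDeriv_fiber hc (hasDerivAt_profile b _))).congr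
      (fun _ => by ring) (by ring) (by ring) (by ring) (by ring)
  have hQ : HasCoframeDeriv (liftCoframe F) (fun _ => Q) p 0 0 0 0 := .const Q
  have h0 : HasCoframeDeriv (liftCoframe F) (fun _ => 0) p 0 0 0 0 := .zero
  simp only [forall_fin_four, liftFrameMetric, frameMetric, frameMetricDeriv, Matrix.of_apply,
    Matrix.cons_val, Matrix.zero_apply]
  and_intros <;> assumption

end Lift

/-! ### The lift as a metric of Taub-NUT type, and its Einstein equation. -/

section LiftMetric

variable {U : Set ℂ} {F : ℂ → ℝ} {p : Fin 4 → ℝ}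

theorem contDiffOn_comp_zOf {φ : ℂ → ℝ} (h : ContDiffOn ℝ ∞ φ U) :
    ContDiffOn ℝ ∞ (fun x : Fin 4 → ℝ => φ (zOf x)) (spacetime U) :=
  h.comp (zCLM 2).contDiff.contDiffOn fun _ hp => hp.1

theorem contDiffOn_tOf (U : Set ℂ) : ContDiffOn ℝ ∞ tOf (spacetime U) := by
  have h1 : ContDiff ℝ ∞ fun x : Fin 4 → ℝ => x 3 / 2 := by fun_prop
  have h2 : ContDiffOn ℝ ∞ (fun x : Fin 4 → ℝ => Real.sin (x 3 / 2) / Real.cos (x 3 / 2))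
      (spacetime U) :=
    (Real.contDiff_sin.comp h1).contDiffOn.div (Real.contDiff_cos.comp h1).contDiffOn
      fun p hp => hp.2
  exact h2.congr fun x _ => Real.tan_eq_sin_div_cos _

theorem contDiffOn_one_add_tOf_sq (U : Set ℂ) :
    ContDiffOn ℝ ∞ (fun x => 1 + tOf x ^ 2) (spacetime U) :=
  contDiffOn_const.add ((contDiffOn_tOf U).pow 2)

theorem one_add_tOf_sq_ne (p : Fin 4 → ℝ) : 1 + tOf p ^ 2 ≠ 0 := by positivity

theorem contDiffOn_liftCoframe (hU : IsOpen U) (hF : ContDiffOn ℝ ∞ F U) : ∀ a b,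
    ContDiffOn ℝ ∞ (fun x => liftCoframe F x a b) (spacetime U) := by
  have h0 : ∀ c : ℝ, ContDiffOn ℝ ∞ (fun _ : Fin 4 → ℝ => c) (spacetime U) :=
    fun c => contDiffOn_const
  have h1 := contDiffOn_comp_zOf (contDiffOn_fderiv_apply hU hF 1)
  have h2 := (contDiffOn_comp_zOf (contDiffOn_fderiv_apply hU hF Complex.I)).neg
  have h3 := (contDiffOn_one_add_tOf_sq U).div_const 2
  simp only [forall_fin_four, liftCoframe, Matrix.of_apply, Matrix.cons_val]
  exact ⟨⟨h0 1, h0 0, h0 0, h0 0⟩, ⟨h0 0, h0 1, h0 0, h0 0⟩, ⟨h2, h1, h0 1, h0 0⟩,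
    ⟨h0 0, h0 0, h0 0, h3⟩⟩

theorem contDiffOn_liftFrame (hU : IsOpen U) (hF : ContDiffOn ℝ ∞ F U) : ∀ a b,
    ContDiffOn ℝ ∞ (fun x => liftFrame F x a b) (spacetime U) := by
  have h0 : ∀ c : ℝ, ContDiffOn ℝ ∞ (fun _ : Fin 4 → ℝ => c) (spacetime U) :=
    fun c => contDiffOn_const
  have h1 := (contDiffOn_comp_zOf (contDiffOn_fderiv_apply hU hF 1)).neg
  have h2 := contDiffOn_comp_zOf (contDiffOn_fderiv_apply hU hF Complex.I)
  have h3 := (h0 2).div (contDiffOn_one_add_tOf_sq U) fun p _ => one_add_tOf_sq_ne p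
  simp only [forall_fin_four, liftFrame, Matrix.of_apply, Matrix.cons_val]
  exact ⟨⟨h0 1, h0 0, h0 0, h0 0⟩, ⟨h0 0, h0 1, h0 0, h0 0⟩, ⟨h2, h1, h0 1, h0 0⟩,
    ⟨h0 0, h0 0, h0 0, h3⟩⟩

theorem liftFrame_mul_liftCoframe (F : ℂ → ℝ) (p : Fin 4 → ℝ) :
    liftFrame F p * liftCoframe F p = 1 := by
  have hT := one_add_tOf_sq_ne p
  simp only [← Matrix.ext_iff, forall_fin_four, Matrix.mul_apply, Fin.sum_univ_four, liftFrame,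
    liftCoframe, Matrix.of_apply, Matrix.cons_val, mul_zero, zero_mul, add_zero, zero_add,
    mul_one, one_mul, Matrix.one_apply]
  and_intros <;> simp
  field_simp
  exact hT

/-- Since λ' = du - F_y dx + F_x dy, its differential is (F_xx + F_yy) dx ∧ dy = 4f dx ∧ dy. The
other coframe forms are closed, the last one because its coefficient depends on r alone. -/
theorem liftCoframe_structure (hU : IsOpen U) (hF : ContDiffOn ℝ ∞ F U)
    (hp : p ∈ spacetime U) : ∀ e k l,
    pd k (fun x => liftCoframe F x e l) p - pd l (fun x => liftCoframe F x e k) p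
      = ∑ c, ∑ d, liftCoframe F p c k * liftCoframe F p d l
        * frameTorsion (mixed F (zOf p)) c d e := by
  obtain ⟨hz, hc⟩ := hp
  have h1 := (hasCoframeDeriv_base (F := F) (differentiableAt_of_smoothOn hU
    (contDiffOn_fderiv_apply hU hF 1) hz)).pd_eq
  have h2 := ((hasCoframeDeriv_base (F := F) (differentiableAt_of_smoothOn hU
    (contDiffOn_fderiv_apply hU hF Complex.I) hz)).neg).pd_eq
  have h3 := (hasCoframeDeriv_fiber (F := F) hc
    ((hasDerivAt_one_add_sq (tOf p)).div_const 2)).pd_eq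
  have h4 := mixed_eq hU hF hz
  simp only [forall_fin_four] at h1 h2 h3
  simp only [forall_fin_four, liftCoframe, Matrix.of_apply, Matrix.cons_val, pd_const, h1, h2, h3,
    frameTorsion, Fin.sum_univ_four, mul_zero, zero_mul, add_zero, zero_add, sub_self]
  rw [h4]
  and_intros <;> first
    | trivial
    | ring

theorem pull_dzForm (p : Fin 4 → ℝ) : pull dzForm p = ![1, Complex.I, 0, 0] := by
  funext i
  fin_cases i <;> rfl

theorem pull_rescaledForm (hU : IsOpen U) (hF : ContDiffOn ℝ ∞ F U) (hz : zOf p ∈ U) :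
    pull (rescaledForm F) p = fun i => 1 / (2 * mixed F (zOf p)) * liftCoframe F p 2 i := by
  have hd : DifferentiableAt ℝ F (zOf p) := differentiableAt_of_smoothOn hU hF hz
  have hz' : zOf (fun i : Fin 3 => p i.castSucc) = zOf p := rfl
  have hs : ∀ i : Fin 3, pull (rescaledForm F) p i.castSucc
      = rescaledForm F (fun i => p i.castSucc) i := fun i => by
    simp only [pull, Fin.snoc_castSucc]
  have h3 : pull (rescaledForm F) p 3 = 0 := Fin.snoc_last (α := fun _ => ℝ) _ _
  have h0 := hs 0
  have h1 := hs 1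
  have h2 := hs 2
  simp only [Fin.castSucc_zero, Fin.castSucc_one, rescaledForm, Pi.smul_apply, smul_eq_mul, hz']
    at h0 h1 h2
  rw [funext_iff]
  simp only [forall_fin_four, liftCoframe, Matrix.of_apply, Matrix.cons_val]
  refine ⟨h0.trans ?_, h1.trans ?_, h2.trans ?_, h3.trans ?_⟩
  · congr 1
    simp [contactForm, dzForm, dZ, fderiv_ofReal hd, hz']
    ring
  · congr 1
    simp [contactForm, dzForm, dZ, fderiv_ofReal hd, hz']
    ring
  · congr 1
    simp [contactForm, dzForm]
  · ring

/-- The Taub-NUT lift. -/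
def taubNUTLift (F : ℂ → ℝ) (q b : ℝ) : Tensor2 4 :=
  liftMetric dzForm (rescaledForm F) (conformalFactor F fun _ => q) (fun _ => 0) (liftH F b)

theorem conformalFactor_sq (hpos : ∀ z ∈ U, 0 < mixed F z) (q : ℝ) (hp : p ∈ spacetime U) :
    conformalFactor F (fun _ => q) p ^ 2 = q ^ 2 * mixed F (zOf p) * (1 + tOf p ^ 2) := by
  rw [one_add_tOf_sq hp.2, conformalFactor, div_pow, mul_pow, Real.sq_sqrt (hpos _ hp.1).le]
  ring

/-- The factor P² = q² f (1 + t²) cancels the 1/(2f) in λ, and (1 + t²) dr/2 = dt absorbs the rest.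
Only q² enters, so both signs of q give the same metric. -/
theorem taubNUTLift_eq (hU : IsOpen U) (hF : ContDiffOn ℝ ∞ F U)
    (hpos : ∀ z ∈ U, 0 < mixed F z) (q b : ℝ) (hp : p ∈ spacetime U) :
    taubNUTLift F q b p
      = (liftCoframe F p)ᵀ * liftFrameMetric F (q ^ 2) b p * liftCoframe F p := by
  have hf := (hpos _ hp.1).ne'
  have hT := one_add_tOf_sq_ne p
  have h2 : ∀ i j, taubNUTLift F q b p i j = 2 * (q ^ 2 * mixed F (zOf p) * (1 + tOf p ^ 2)) *
      (((![1, Complex.I, 0, 0] : Fin 4 → ℂ) i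
        * starRingEnd ℂ ((![1, Complex.I, 0, 0] : Fin 4 → ℂ) j)).re
      + (1 / (2 * mixed F (zOf p)) * liftCoframe F p 2 i * ((Pi.single 3 1 : Fin 4 → ℝ) j
          + liftH F b p * (1 / (2 * mixed F (zOf p)) * liftCoframe F p 2 j))
        + ((Pi.single 3 1 : Fin 4 → ℝ) i
          + liftH F b p * (1 / (2 * mixed F (zOf p)) * liftCoframe F p 2 i))
          * (1 / (2 * mixed F (zOf p)) * liftCoframe F p 2 j)) / 2) := fun i j => by
    simp only [taubNUTLift, liftMetric, conformalFactor_sq hpos q hp, pull_dzForm,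
      pull_rescaledForm hU hF hp.1, liftForm, symProd, Matrix.smul_apply, Matrix.add_apply,
      Matrix.of_apply, smul_eq_mul, zero_mul, Complex.zero_re, mul_zero, add_zero]
  rw [← Matrix.ext_iff]
  simp only [h2, liftH]
  simp only [forall_fin_four, Matrix.mul_apply, Fin.sum_univ_four, Matrix.transpose_apply,
    liftCoframe, liftFrameMetric, frameMetric, profile, Matrix.of_apply, Matrix.cons_val,
    mul_zero, zero_mul, add_zero, zero_add, mul_one, one_mul]
  and_intros <;> simp <;> field_simp <;> ring

theorem liftFrameMetric_symm (F : ℂ → ℝ) (Q b : ℝ) (p : Fin 4 → ℝ) :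
    (liftFrameMetric F Q b p).IsSymm := by
  refine Matrix.IsSymm.ext ?_
  simp only [forall_fin_four, liftFrameMetric, frameMetric, Matrix.of_apply, Matrix.cons_val,
    and_self]

theorem liftFrameMetric_det (hpos : ∀ z ∈ U, 0 < mixed F z) {Q : ℝ} (hQ : Q ≠ 0) (b : ℝ)
    (hp : p ∈ spacetime U) : IsUnit (liftFrameMetric F Q b p).det := by
  have hf := (hpos _ hp.1).ne'
  have hT := one_add_tOf_sq_ne p
  rw [isUnit_iff_ne_zero, liftFrameMetric, frameMetric]
  simp [Matrix.det_succ_row_zero, Fin.sum_univ_succ, hf, hT, hQ]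

theorem isMovingFrame_taubNUTLift (hU : IsOpen U) (hF : ContDiffOn ℝ ∞ F U)
    (hpos : ∀ z ∈ U, 0 < mixed F z) {q : ℝ} (hq : q ≠ 0) (b : ℝ) :
    IsMovingFrame (taubNUTLift F q b) (spacetime U) (liftCoframe F) (liftFrame F)
      (liftFrameMetric F (q ^ 2) b) (liftConnection F b) (liftConnectionDeriv F b)
      (fun p => frameTorsion (mixed F (zOf p))) where
  isOpen := isOpen_spacetime hU
  coframe_smooth := contDiffOn_liftCoframe hU hF
  frame_smooth := contDiffOn_liftFrame hU hF
  frame_mul_coframe p _ := liftFrame_mul_liftCoframe F p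
  metric_eq p hp := taubNUTLift_eq hU hF hpos q b hp
  metric_symm p _ := liftFrameMetric_symm F _ b p
  metric_det p hp := liftFrameMetric_det hpos (pow_ne_zero 2 hq) b hp
  metric_diff p hp i j := (liftFrameMetric_hasCoframeDeriv hU hF hpos _ b hp i j).differentiableAt
  connection_diff p hp c i j :=
    (liftConnection_hasCoframeDeriv hU hF hpos b hp c i j).differentiableAt
  structure_eq p hp := liftCoframe_structure hU hF hp
  compatible p hp k := by
    ext i j
    rw [pdM, Matrix.of_apply, (liftFrameMetric_hasCoframeDeriv hU hF hpos _ b hp i j).pd_eq k]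
    simp only [frameConnection_compatible, Fin.sum_univ_four, Matrix.add_apply,
      Matrix.smul_apply, smul_eq_mul, liftConnection, liftFrameMetric]
  torsion_free p _ := frameConnection_torsion _ _ _ _ _
  connection_deriv p hp d k := by
    ext i j
    rw [pdM, Matrix.of_apply, (liftConnection_hasCoframeDeriv hU hF hpos b hp d i j).pd_eq k]
    simp only [Fin.sum_univ_four, Matrix.add_apply, Matrix.smul_apply, smul_eq_mul]

theorem frameCurvature_lift (F : ℂ → ℝ) (b : ℝ) (c d : Fin 4) (p : Fin 4 → ℝ) :
    frameCurvature (liftConnection F b) (liftConnectionDeriv F b)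
      (fun p => frameTorsion (mixed F (zOf p))) c d p
      = pointCurvature b (mixed F (zOf p)) (logDeriv F 1 (zOf p)) (logDeriv F Complex.I (zOf p))
        (fderiv ℝ (logDeriv F 1) (zOf p) 1) (fderiv ℝ (logDeriv F 1) (zOf p) Complex.I)
        (fderiv ℝ (logDeriv F Complex.I) (zOf p) Complex.I) (tOf p) c d := rfl

theorem isEinsteinOn_taubNUTLift (hU : IsOpen U) (hF : ContDiffOn ℝ ∞ F U)
    (hpos : ∀ z ∈ U, 0 < mixed F z) {Λo Λ q : ℝ} (hq : q ≠ 0)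
    (hKE : IsEinsteinOn (kahlerMetric F) {v | zOf v ∈ U} Λo)
    (hqΛ : Λ * q ^ 2 = 3 * (Λo / 4)) :
    IsEinsteinOn (taubNUTLift F q (Λo / 4)) (spacetime U) Λ := by
  refine (isMovingFrame_taubNUTLift hU hF hpos hq (Λo / 4)).isEinsteinOn fun p hp i j => ?_
  simp only [frameCurvature_lift]
  -- The constant b = Λo/4 is forced here: the Laplacian of log f is -4 Λo f, and -16 b f is
  -- required.
  refine pointCurvature_ricci hqΛ ?_ i j
  rw [laplacian_log_mixed hU hF hpos hKE hp.1]
  ring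

end LiftMetric

/-! ### Smoothness, signature and the shearfree condition. -/

section Properties

variable {U : Set ℂ} {F : ℂ → ℝ} {p : Fin 4 → ℝ}

theorem contDiffOn_profile (U : Set ℂ) (b : ℝ) :
    ContDiffOn ℝ ∞ (fun x => profile b (tOf x)) (spacetime U) :=
  (contDiffOn_const.mul (contDiffOn_one_add_tOf_sq U)).add
    ((contDiffOn_tOf U).div (contDiffOn_one_add_tOf_sq U) fun p _ => one_add_tOf_sq_ne p)

theorem contDiffOn_profile₁ (U : Set ℂ) (b : ℝ) :
    ContDiffOn ℝ ∞ (fun x => profile₁ b (tOf x)) (spacetime U) :=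
  (contDiffOn_const.mul (contDiffOn_tOf U)).add
    ((contDiffOn_const.sub ((contDiffOn_tOf U).pow 2)).div
      ((contDiffOn_one_add_tOf_sq U).pow 2) fun p _ => pow_ne_zero 2 (one_add_tOf_sq_ne p))

theorem contDiffOn_liftH (hU : IsOpen U) (hF : ContDiffOn ℝ ∞ F U) (b : ℝ) :
    ContDiffOn ℝ ∞ (liftH F b) (spacetime U) :=
  (contDiffOn_const.mul (contDiffOn_comp_zOf (contDiffOn_mixed hU hF))).mul
    (contDiffOn_const.add ((contDiffOn_tOf U).div ((contDiffOn_one_add_tOf_sq U).pow 2)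
      fun p _ => pow_ne_zero 2 (one_add_tOf_sq_ne p)))

theorem contDiffOn_liftFrameMetric (hU : IsOpen U) (hF : ContDiffOn ℝ ∞ F U) (Q b : ℝ) :
    ∀ i j, ContDiffOn ℝ ∞ (fun x => liftFrameMetric F Q b x i j) (spacetime U) := by
  have h0 : ∀ c : ℝ, ContDiffOn ℝ ∞ (fun _ : Fin 4 → ℝ => c) (spacetime U) :=
    fun c => contDiffOn_const
  have h1 := ((h0 (2 * Q)).mul (contDiffOn_comp_zOf (contDiffOn_mixed hU hF))).mul
    (contDiffOn_one_add_tOf_sq U)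
  have h2 := (h0 Q).mul (contDiffOn_profile U b)
  simp only [forall_fin_four, liftFrameMetric, frameMetric, Matrix.of_apply, Matrix.cons_val]
  exact ⟨⟨h1, h0 0, h0 0, h0 0⟩, ⟨h0 0, h1, h0 0, h0 0⟩, ⟨h0 0, h0 0, h2, h0 Q⟩,
    ⟨h0 0, h0 0, h0 Q, h0 0⟩⟩

theorem isLorentzianOn_taubNUTLift (hU : IsOpen U) (hF : ContDiffOn ℝ ∞ F U)
    (hpos : ∀ z ∈ U, 0 < mixed F z) {q : ℝ} (hq : q ≠ 0) (b : ℝ) :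
    IsLorentzianOn (taubNUTLift F q b) (spacetime U) := by
  refine ⟨fun i j => ?_, fun p hp => ⟨?_, ?_⟩⟩
  · have h1 : ContDiffOn ℝ ∞ (fun x => ∑ b', (∑ a, liftCoframe F x a i
        * liftFrameMetric F (q ^ 2) b x a b') * liftCoframe F x b' j) (spacetime U) :=
      ContDiffOn.sum fun b' _ => (ContDiffOn.sum fun a _ =>
        (contDiffOn_liftCoframe hU hF a i).mul (contDiffOn_liftFrameMetric hU hF _ b a b')).mul
          (contDiffOn_liftCoframe hU hF b' j)
    refine h1.congr fun x hx => ?_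
    rw [taubNUTLift_eq hU hF hpos q b hx]
    simp only [Matrix.mul_apply, Matrix.transpose_apply]
  · rw [taubNUTLift_eq hU hF hpos q b hp]
    unfold Matrix.IsSymm
    simp [Matrix.mul_assoc, (liftFrameMetric_symm F _ b p).eq]
  · have hθE : liftCoframe F p * liftFrame F p = 1 :=
      mul_eq_one_comm.mp (liftFrame_mul_liftCoframe F p)
    have hf := hpos _ hp.1
    have hT := one_add_tOf_sq_ne p
    have hpos' : 0 < 2 * q ^ 2 * mixed F (zOf p) * (1 + tOf p ^ 2) := by positivity
    obtain ⟨N, hN⟩ : ∃ N : ℝ, N * N * (2 * q ^ 2 * mixed F (zOf p) * (1 + tOf p ^ 2)) = 1 :=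
      ⟨(√(2 * q ^ 2 * mixed F (zOf p) * (1 + tOf p ^ 2)))⁻¹, by
        rw [← mul_inv, Real.mul_self_sqrt hpos'.le, inv_mul_cancel₀ hpos'.ne']⟩
    -- The base vectors are normalised by `N`. In the (λ', t)-plane, with matrix q² times (B, 1; 1,
    -- 0), the vectors (1, (±1 - B)/2)/q are orthogonal of square ±1.
    let B : Matrix (Fin 4) (Fin 4) ℝ :=
      !![N, 0, 0, 0; 0, N, 0, 0; 0, 0, 1 / q, 1 / q;
         0, 0, (1 - profile b (tOf p)) / 2 / q, (-1 - profile b (tOf p)) / 2 / q]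
    have hB : Bᵀ * liftFrameMetric F (q ^ 2) b p * B = Matrix.diagonal ![1, 1, 1, -1] := by
      rw [← Matrix.ext_iff]
      simp only [forall_fin_four, B, Matrix.mul_apply, Fin.sum_univ_four, Matrix.transpose_apply,
        liftFrameMetric, frameMetric, Matrix.of_apply, Matrix.cons_val, mul_zero, zero_mul,
        add_zero, zero_add, Matrix.diagonal_apply]
      and_intros <;> simp
      · linear_combination hN
      · linear_combination hN
      all_goals
        field_simp
        ring
    refine ⟨liftFrame F p * B, ?_⟩
    have h2 : (liftFrame F p)ᵀ * (liftCoframe F p)ᵀ = 1 := by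
      rw [← Matrix.transpose_mul, hθE, Matrix.transpose_one]
    rw [taubNUTLift_eq hU hF hpos q b hp, ← hB, Matrix.transpose_mul]
    calc _ = Bᵀ * ((liftFrame F p)ᵀ * (liftCoframe F p)ᵀ) * liftFrameMetric F (q ^ 2) b p
          * (liftCoframe F p * liftFrame F p) * B := by noncomm_ring
      _ = _ := by rw [h2, hθE, Matrix.mul_one, Matrix.mul_one]

theorem HasCoframeDeriv.add {θ : Tensor2 4} {φ ψ : (Fin 4 → ℝ) → ℝ}
    {d₀ d₁ d₂ d₃ e₀ e₁ e₂ e₃ : ℝ} (h : HasCoframeDeriv θ φ p d₀ d₁ d₂ d₃)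
    (h' : HasCoframeDeriv θ ψ p e₀ e₁ e₂ e₃) :
    HasCoframeDeriv θ (fun x => φ x + ψ x) p (d₀ + e₀) (d₁ + e₁) (d₂ + e₂) (d₃ + e₃) :=
  ⟨h.1.add h'.1, fun k => by rw [pd_add h.1 h'.1, h.2, h'.2]; ring⟩

/-- The entries of the lift in terms of the contact form. -/
theorem taubNUTLift_apply (hU : IsOpen U) (hF : ContDiffOn ℝ ∞ F U)
    (hpos : ∀ z ∈ U, 0 < mixed F z) (q b : ℝ) (hp : p ∈ spacetime U) : ∀ i j,
    taubNUTLift F q b p i j = q ^ 2 * (2 * mixed F (zOf p) * (1 + tOf p ^ 2)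
        * Matrix.diagonal (![1, 1, 0, 0] : Fin 4 → ℝ) i j
      + profile b (tOf p) * (liftCoframe F p 2 i * liftCoframe F p 2 j)
      + (1 + tOf p ^ 2) / 2 * (liftCoframe F p 2 i * (Pi.single 3 1 : Fin 4 → ℝ) j
        + (Pi.single 3 1 : Fin 4 → ℝ) i * liftCoframe F p 2 j)) := by
  rw [taubNUTLift_eq hU hF hpos q b hp]
  simp only [forall_fin_four, Matrix.mul_apply, Fin.sum_univ_four, Matrix.transpose_apply,
    liftCoframe, liftFrameMetric, frameMetric, Matrix.of_apply, Matrix.cons_val,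
    mul_zero, zero_mul, add_zero, zero_add, mul_one, one_mul, Matrix.diagonal_apply]
  and_intros <;> simp <;> ring

/-- The forms dx, dy, λ' and dr are independent of r, and ∂_r(1 + t²) = t (1 + t²). Hence every part
of the metric scales at the rate t except the λ'² part, which leaves the displayed error. -/
theorem pd_three_taubNUTLift (hU : IsOpen U) (hF : ContDiffOn ℝ ∞ F U)
    (hpos : ∀ z ∈ U, 0 < mixed F z) (q b : ℝ) (hp : p ∈ spacetime U) (i j : Fin 4) :
    pd 3 (fun x => taubNUTLift F q b x i j) p = tOf p * taubNUTLift F q b p i j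
      + q ^ 2 * ((1 + tOf p ^ 2) / 2 * profile₁ b (tOf p) - tOf p * profile b (tOf p))
        * (liftCoframe F p 2 i * liftCoframe F p 2 j) := by
  obtain ⟨hz, hc⟩ := id hp
  -- The base derivatives may stay unspecified: ∂_r pairs to zero with dx, dy and λ'.
  have hl : ∀ i, ∃ d₀ d₁, HasCoframeDeriv (liftCoframe F) (fun x => liftCoframe F x 2 i) p
      d₀ d₁ 0 0 := by
    have h1 := hasCoframeDeriv_base (F := F) (differentiableAt_of_smoothOn hU
      (contDiffOn_fderiv_apply hU hF 1) hz)
    have h2 := (hasCoframeDeriv_base (F := F) (differentiableAt_of_smoothOn hU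
      (contDiffOn_fderiv_apply hU hF Complex.I) hz)).neg
    simp only [neg_zero] at h2
    simp only [forall_fin_four, liftCoframe, Matrix.of_apply, Matrix.cons_val]
    exact ⟨⟨_, _, h2⟩, ⟨_, _, h1⟩, ⟨_, _, .const 1⟩, ⟨_, _, .const 0⟩⟩
  obtain ⟨a₀, a₁, ha⟩ := hl i
  obtain ⟨b₀, b₁, hb⟩ := hl j
  have hf := hasCoframeDeriv_base (F := F) (differentiableAt_of_smoothOn hU
    (contDiffOn_mixed hU hF) hz)
  have hT := hasCoframeDeriv_fiber (F := F) hc (hasDerivAt_one_add_sq (tOf p))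
  have hT' := hasCoframeDeriv_fiber (F := F) hc ((hasDerivAt_one_add_sq (tOf p)).div_const 2)
  have hB := hasCoframeDeriv_fiber (F := F) hc (hasDerivAt_profile b (tOf p))
  have h1 := ((HasCoframeDeriv.const (θ := liftCoframe F) (p := p) (q ^ 2)).mul
    ((((((HasCoframeDeriv.const 2).mul hf).mul hT).mul
      (.const (Matrix.diagonal (![1, 1, 0, 0] : Fin 4 → ℝ) i j))).add (hB.mul (ha.mul hb))).add
      (hT'.mul ((ha.mul (.const ((Pi.single 3 1 : Fin 4 → ℝ) j))).add
        ((HasCoframeDeriv.const ((Pi.single 3 1 : Fin 4 → ℝ) i)).mul hb))))).pd_eq 3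
  have c0 : liftCoframe F p 0 3 = 0 := rfl
  have c1 : liftCoframe F p 1 3 = 0 := rfl
  have c2 : liftCoframe F p 2 3 = 0 := rfl
  have c3 : liftCoframe F p 3 3 = (1 + tOf p ^ 2) / 2 := rfl
  refine (pd_congr ?_ 3).trans (h1.trans ?_)
  · filter_upwards [(isOpen_spacetime hU).mem_nhds hp] with x hx using
      taubNUTLift_apply hU hF hpos q b hx i j
  · rw [taubNUTLift_apply hU hF hpos q b hp, c0, c1, c2, c3]
    ring

theorem taubNUTLift_mulVec_partialR (hU : IsOpen U) (hF : ContDiffOn ℝ ∞ F U)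
    (hpos : ∀ z ∈ U, 0 < mixed F z) (q b : ℝ) (hp : p ∈ spacetime U) :
    taubNUTLift F q b p *ᵥ partialR p
      = fun i => q ^ 2 * ((1 + tOf p ^ 2) / 2) * liftCoframe F p 2 i := by
  have c2 : liftCoframe F p 2 3 = 0 := rfl
  have hd : ∀ i : Fin 4, Matrix.diagonal (![1, 1, 0, 0] : Fin 4 → ℝ) i 3 = 0 := by
    simp [Matrix.diagonal_apply]
  funext i
  simp only [partialR, Matrix.mulVec_single_one, Matrix.col_apply,
    taubNUTLift_apply hU hF hpos q b hp, c2, hd, Pi.single_eq_same]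
  ring

/-- The one-form dual to ∂_r is q² (1 + t²)/2 times λ'. The λ'² error in the Lie derivative is
therefore a product of it with a multiple of λ', which serves as ψ; ρ is t. -/
theorem isShearfreeOn_taubNUTLift (hU : IsOpen U) (hF : ContDiffOn ℝ ∞ F U)
    (hpos : ∀ z ∈ U, 0 < mixed F z) (q b : ℝ) :
    IsShearfreeOn (taubNUTLift F q b) (spacetime U) partialR := by
  refine ⟨contDiffOn_const, fun p hp => ⟨?_, ?_⟩, tOf, fun x i =>
    (profile₁ b (tOf x) - 2 * tOf x * (profile b (tOf x) / (1 + tOf x ^ 2)))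
      * liftCoframe F x 2 i, contDiffOn_tOf U, ?_, fun p hp => ?_⟩
  · simp [partialR]
  · rw [taubNUTLift_mulVec_partialR hU hF hpos q b hp]
    simp [partialR, liftCoframe]
  · refine contDiffOn_pi.2 fun i => ?_
    exact ((contDiffOn_profile₁ U b).sub ((contDiffOn_const.mul (contDiffOn_tOf U)).mul
      ((contDiffOn_profile U b).div (contDiffOn_one_add_tOf_sq U)
        fun p _ => one_add_tOf_sq_ne p))).mul (contDiffOn_liftCoframe hU hF 2 i)
  · have hT := one_add_tOf_sq_ne p
    have hk : ∀ l i, pd i (fun x => partialR x l) p = 0 := fun l i => pd_const _ i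
    ext i j
    have h1 : lieDerivMetric partialR (taubNUTLift F q b) p i j
        = pd 3 (fun x => taubNUTLift F q b x i j) p := by
      simp only [lieDerivMetric, Matrix.of_apply, hk, mul_zero, add_zero]
      simp [partialR, Pi.single_apply]
    rw [h1, pd_three_taubNUTLift hU hF hpos q b hp,
      taubNUTLift_mulVec_partialR hU hF hpos q b hp]
    simp only [Matrix.add_apply, Matrix.smul_apply, smul_eq_mul, symProd, Matrix.of_apply]
    field_simp
    ring

end Properties

/-! ### The Petrov type. -/

section Petrov

variable {U : Set ℂ} {F : ℂ → ℝ} {p : Fin 4 → ℝ}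

/-- The complex vector with the components `v` in the frame `E`. -/
def ofFrame (E : Tensor2 4) (p : Fin 4 → ℝ) (v : Fin 4 → ℂ) : Fin 4 → ℂ :=
  (E p).map (fun x => (x : ℂ)) *ᵥ v

theorem frameComponents_ofFrame {θ E : Tensor2 4} (h : θ p * E p = 1) (v : Fin 4 → ℂ) :
    frameComponents θ p (ofFrame E p v) = v := by
  have h1 : (θ p).map (fun x => (x : ℂ)) * (E p).map (fun x => (x : ℂ)) = 1 := by
    have := congrArg (fun A : Matrix (Fin 4) (Fin 4) ℝ => A.map Complex.ofRealHom) h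
    exact (by simpa [Matrix.map_mul] using this :
      (θ p).map Complex.ofRealHom * (E p).map Complex.ofRealHom = 1)
  rw [frameComponents, ofFrame, Matrix.mulVec_mulVec, h1, Matrix.one_mulVec]

theorem toC_mulVec (E : Tensor2 4) (p v : Fin 4 → ℝ) :
    toC (E p *ᵥ v) = ofFrame E p (toC v) := by
  funext i
  simp [toC, ofFrame, Matrix.mulVec, dotProduct]

theorem bar_ofFrame (E : Tensor2 4) (p : Fin 4 → ℝ) (v : Fin 4 → ℂ) :
    bar (ofFrame E p v) = ofFrame E p (bar v) := by
  funext i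
  simp [bar, ofFrame, Matrix.mulVec, dotProduct]

/-- The b part of the profile cancels against -b/Q. What remains is (t (3 - t²) + i (1 - 3t²))/(2Q
(1 + t²)³) = -(t + i)³/(2Q (1 + t²)³), and the two real polynomials have no common real zero. -/
theorem taubNUT_weylScalar_ne_zero {Q b f t : ℝ} (hQ : Q ≠ 0) (hf : f ≠ 0) :
    ((1 / Q * (2 * (Q * f * (t * profile₁ b t + 2 * (profile b t * (1 + t ^ 2)⁻¹))))
        * (1 / (4 * Q * f * (1 + t ^ 2))) - b / Q : ℝ) : ℂ)
      + ((1 / Q * (2 * (Q * f * (profile₁ b t - 2 * (t * (profile b t * (1 + t ^ 2)⁻¹)))))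
        * (1 / (4 * Q * f * (1 + t ^ 2))) : ℝ) : ℂ) * Complex.I ≠ 0 := by
  have hT : (1 + t ^ 2) ≠ 0 := by positivity
  intro h
  have hre := congrArg Complex.re h
  have him := congrArg Complex.im h
  simp only [Complex.add_re, Complex.add_im, Complex.re_ofReal_mul, Complex.im_ofReal_mul,
    Complex.ofReal_re, Complex.ofReal_im, Complex.I_re, Complex.I_im, mul_zero, mul_one,
    add_zero, zero_add, Complex.zero_re, Complex.zero_im] at hre him
  have h1 : t * (3 - t ^ 2) = 0 := by
    rw [profile, profile₁] at hre
    field_simp at hre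
    linear_combination (1 / 2) * hre
  have h2 : 1 - 3 * t ^ 2 = 0 := by
    rw [profile, profile₁] at him
    field_simp at him
    linear_combination (1 / 2) * him
  rcases mul_eq_zero.1 h1 with h3 | h3
  · rw [h3] at h2
    norm_num at h2
  · linarith

theorem isPetrovD_taubNUTLift (hU : IsOpen U) (hF : ContDiffOn ℝ ∞ F U)
    (hpos : ∀ z ∈ U, 0 < mixed F z) {Λ q b : ℝ} (hq : q ≠ 0) (hqΛ : Λ * q ^ 2 = 3 * b)
    (hE : IsEinsteinOn (taubNUTLift F q b) (spacetime U) Λ) (hp : p ∈ spacetime U) :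
    IsPetrovD (taubNUTLift F q b) p := by
  have hM := isMovingFrame_taubNUTLift hU hF hpos hq b
  have hθE := hM.coframe_mul_frame hp
  have hf := hpos _ hp.1
  have hQ : q ^ 2 ≠ 0 := pow_ne_zero 2 hq
  have hT := one_add_tOf_sq_ne p
  have hpos' : 0 < 4 * q ^ 2 * mixed F (zOf p) * (1 + tOf p ^ 2) := by positivity
  -- The normalisation g(m, m̄) = 1, since g(m, m̄) = 2N² · 2q² f (1 + t²).
  obtain ⟨N, hN⟩ : ∃ N : ℝ, N * N = 1 / (4 * q ^ 2 * mixed F (zOf p) * (1 + tOf p ^ 2)) :=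
    ⟨(√(4 * q ^ 2 * mixed F (zOf p) * (1 + tOf p ^ 2)))⁻¹, by
      rw [← mul_inv, Real.mul_self_sqrt hpos'.le, one_div]⟩
  have hΛ : Λ = 3 * (b / q ^ 2) := by
    field_simp
    linarith
  let k : Fin 4 → ℝ := ![0, 0, 0, 1]
  -- The second null direction of the (λ', t)-plane: E₂ has square q² B and product q² with E₃, so
  -- E₂ - (B/2) E₃ is null; the factor 1/q² gives g(k, l) = 1.
  let l : Fin 4 → ℝ := ![0, 0, 1 / q ^ 2, -(profile b (tOf p) / 2) * (1 / q ^ 2)]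
  let m : Fin 4 → ℂ := ![N, N * Complex.I, 0, 0]
  have hk : toC k = ![0, 0, 0, 1] := by
    rw [funext_iff, forall_fin_four]
    simp [toC, k]
  have hl : toC l = ![0, 0, ((1 / q ^ 2 : ℝ) : ℂ),
      ((-(profile b (tOf p) / 2) * (1 / q ^ 2) : ℝ) : ℂ)] := by
    rw [funext_iff, forall_fin_four]
    refine ⟨?_, ?_, rfl, rfl⟩ <;> simp [toC, l]
  have hm : bar m = ![(N : ℂ), -(N * Complex.I), 0, 0] := by
    rw [funext_iff, forall_fin_four]
    simp [bar, m]
  have hg : ∀ v w : Fin 4 → ℂ,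
      metricC (taubNUTLift F q b) p (ofFrame (liftFrame F) p v) (ofFrame (liftFrame F) p w)
        = ((2 * q ^ 2 * mixed F (zOf p) * (1 + tOf p ^ 2) : ℝ) : ℂ) * (v 0 * w 0 + v 1 * w 1)
          + (q ^ 2 : ℝ) * ((profile b (tOf p) : ℝ) * v 2 * w 2 + v 2 * w 3 + v 3 * w 2) := by
    intro v w
    rw [hM.metricC_eq hp, frameComponents_ofFrame hθE, frameComponents_ofFrame hθE]
    simp only [Fin.sum_univ_four, liftFrameMetric, frameMetric, Matrix.of_apply, Matrix.cons_val,
      Complex.ofReal_zero, zero_mul, add_zero, zero_add]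
    push_cast
    ring
  have hI := Complex.I_mul_I
  have hNc : (N : ℂ) * N = ((1 / (4 * q ^ 2 * mixed F (zOf p) * (1 + tOf p ^ 2)) : ℝ) : ℂ) := by
    rw [← hN]
    push_cast
    ring
  have t1 : metricC (taubNUTLift F q b) p (ofFrame (liftFrame F) p (toC k))
      (ofFrame (liftFrame F) p (toC k)) = 0 := by
    rw [hg, hk]
    simp
  have t2 : metricC (taubNUTLift F q b) p (ofFrame (liftFrame F) p (toC l))
      (ofFrame (liftFrame F) p (toC l)) = 0 := by
    rw [hg, hl]
    simp only [Matrix.cons_val]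
    push_cast
    ring
  have t3 : metricC (taubNUTLift F q b) p (ofFrame (liftFrame F) p (toC k))
      (ofFrame (liftFrame F) p (toC l)) = 1 := by
    rw [hg, hl, hk]
    have : (q : ℂ) ≠ 0 := by exact_mod_cast hq
    simp only [Matrix.cons_val]
    push_cast
    field_simp
    ring
  have t4 : metricC (taubNUTLift F q b) p (ofFrame (liftFrame F) p (toC k))
      (ofFrame (liftFrame F) p m) = 0 := by
    rw [hg, hk]
    simp [m]
  have t5 : metricC (taubNUTLift F q b) p (ofFrame (liftFrame F) p (toC l))
      (ofFrame (liftFrame F) p m) = 0 := by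
    rw [hg, hl]
    simp [m]
  have t5' : metricC (taubNUTLift F q b) p (ofFrame (liftFrame F) p m)
      (ofFrame (liftFrame F) p (toC l)) = 0 := by
    rw [← t5, hg, hg]
    ring
  have t6 : metricC (taubNUTLift F q b) p (ofFrame (liftFrame F) p m)
      (ofFrame (liftFrame F) p m) = 0 := by
    rw [hg]
    simp only [m, Matrix.cons_val]
    linear_combination ((2 * q ^ 2 * mixed F (zOf p) * (1 + tOf p ^ 2) : ℝ) : ℂ) * N * N * hI
  have t7 : metricC (taubNUTLift F q b) p (ofFrame (liftFrame F) p m)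
      (ofFrame (liftFrame F) p (bar m)) = 1 := by
    rw [hg, hm]
    simp only [m, Matrix.cons_val]
    have h1 : ((2 * q ^ 2 * mixed F (zOf p) * (1 + tOf p ^ 2) : ℝ) : ℂ) * (2 * (N * N)) = 1 := by
      rw [hNc]
      norm_cast
      field_simp
      ring
    linear_combination h1
      - ((2 * q ^ 2 * mixed F (zOf p) * (1 + tOf p ^ 2) : ℝ) : ℂ) * N * N * hI
  have t8 : metricC (taubNUTLift F q b) p (ofFrame (liftFrame F) p (toC k))
      (ofFrame (liftFrame F) p (bar m)) = 0 := by
    rw [hg, hk, hm]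
    simp
  have t9 : metricC (taubNUTLift F q b) p (ofFrame (liftFrame F) p (toC l))
      (ofFrame (liftFrame F) p (bar m)) = 0 := by
    rw [hg, hl, hm]
    simp
  set R := pointRiemann (q ^ 2) b (mixed F (zOf p)) (logDeriv F 1 (zOf p))
    (logDeriv F Complex.I (zOf p)) (fderiv ℝ (logDeriv F 1) (zOf p) 1)
    (fderiv ℝ (logDeriv F 1) (zOf p) Complex.I)
    (fderiv ℝ (logDeriv F Complex.I) (zOf p) Complex.I) (tOf p) with hR
  obtain ⟨⟨a1, a2, a3, a4⟩, ⟨b1, b2, b3, b4⟩, ⟨c1, c2, c3, c4⟩, ⟨d1, d2, d3, d4⟩,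
    ⟨e1, e2, e3, e4⟩, ⟨f1, f2, f3, f4⟩, s1, s2⟩ := pointRiemann_eq (q ^ 2) b (mixed F (zOf p))
    (logDeriv F 1 (zOf p)) (logDeriv F Complex.I (zOf p))
    (fderiv ℝ (logDeriv F 1) (zOf p) 1) (fderiv ℝ (logDeriv F 1) (zOf p) Complex.I)
    (fderiv ℝ (logDeriv F Complex.I) (zOf p) Complex.I) (tOf p)
  rw [← hR] at a1 a2 a3 a4 b1 b2 b3 b4 c1 c2 c3 c4 d1 d2 d3 d4 e1 e2 e3 e4 f1 f2 f3 f4 s1 s2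
  have hW : ∀ v w x y : Fin 4 → ℂ, weylC (taubNUTLift F q b) p (ofFrame (liftFrame F) p v)
      (ofFrame (liftFrame F) p w) (ofFrame (liftFrame F) p x) (ofFrame (liftFrame F) p y)
      = ∑ a, ∑ b, (∑ c, ∑ d, (R a b c d : ℂ) * x c * y d) * v a * w b - Λ / 3
        * (metricC (taubNUTLift F q b) p (ofFrame (liftFrame F) p v) (ofFrame (liftFrame F) p x)
          * metricC (taubNUTLift F q b) p (ofFrame (liftFrame F) p w) (ofFrame (liftFrame F) p y)
          - metricC (taubNUTLift F q b) p (ofFrame (liftFrame F) p v) (ofFrame (liftFrame F) p y)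
          * metricC (taubNUTLift F q b) p (ofFrame (liftFrame F) p w)
            (ofFrame (liftFrame F) p x)) := by
    intro v w x y
    rw [hM.weylC_eq hp (hE p hp)]
    simp only [frameComponents_ofFrame hθE, frameCurvature_lift]
    rfl
  refine ⟨liftFrame F p *ᵥ k, liftFrame F p *ᵥ l, ofFrame (liftFrame F) p m, ?_, ?_⟩
  · simp only [IsNullTetrad, toC_mulVec, bar_ofFrame]
    exact ⟨t1, t2, t3, t4, t5, t6, t7⟩
  · simp only [weylScalar, toC_mulVec, bar_ofFrame, Matrix.cons_val]
    refine ⟨?_, ?_, ?_, ?_, ?_⟩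
    · rw [hW, t1, t4, hk]
      simp [Fin.sum_univ_four, m, a1, a2, a3, a4]
    · rw [hW, t1, t4, hk, hl]
      simp [Fin.sum_univ_four, m, s1, s2, f1, f2]
    -- Ψ₂: the E₃ component of l drops out because R(k, ·, k, ·) vanishes on the base directions,
    -- and the metric products leave just -Λ/3 = -b/q².
    · rw [hW, t3, t5', t7, t8, hk, hl, hm]
      have h1 := taubNUT_weylScalar_ne_zero (b := b) (t := tOf p) hQ hf.ne'
      rw [← hN] at h1
      refine fun h0 => h1 ?_
      rw [← h0, hΛ]
      simp only [Fin.sum_univ_four, m, Matrix.cons_val, mul_zero, zero_mul, add_zero, zero_add,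
        a1, a2, a3, a4, b1, b2, b3, b4, Complex.ofReal_zero]
      push_cast
      linear_combination (1 / (q : ℂ) ^ 2 * (q ^ 2 * mixed F (zOf p) * (tOf p * profile₁ b (tOf p)
        + 2 * (profile b (tOf p) * (1 + tOf p ^ 2 : ℂ)⁻¹))) * N * N) * hI
    · rw [hW, t2, t8, t9, hk, hl, hm]
      simp [Fin.sum_univ_four, e1, e2, e3, e4, f1, f2, f3, f4]
    -- Ψ₄: already R(l, ·, l, ·) vanishes on the base directions. Its diagonal entries are multiples
    -- of B r - (B/2)(r + r), and in the off-diagonal ones s and -s cancel.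
    · rw [hW, t2, t9, hl, hm]
      simp only [Fin.sum_univ_four, Matrix.cons_val, mul_zero, zero_mul, add_zero, zero_add,
        a1, a2, a3, a4, b1, b2, b3, b4, c1, c2, c3, c4, d1, d2, d3, d4, Complex.ofReal_zero]
      push_cast
      linear_combination (0 : ℂ) * hI

end Petrov

end ShearfreeLift
end

/-! ### The main theorem. -/

open ShearfreeLift in
theorem mainTheorem3 (U : Set ℂ) (hU : IsOpen U) (F : ℂ → ℝ) (hF : ContDiffOn ℝ ∞ F U)
    (hpos : ∀ z ∈ U, 0 < mixed F z) (Λo Λ : ℝ)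
    (hKE : IsEinsteinOn (kahlerMetric F) {v | zOf v ∈ U} Λo)
    (hΛ : 0 < Λo * Λ) (q : ℝ)
    (hq : q = √(3 * Λo / (4 * Λ)) ∨ q = -√(3 * Λo / (4 * Λ))) :
    SolvesLogisticOn F Λ U (fun _ => q) ∧
    ∃ (P : (Fin 4 → ℝ) → ℝ) (W : (Fin 4 → ℝ) → ℂ) (H : (Fin 4 → ℝ) → ℝ) (g : Tensor2 4),
      P = conformalFactor F (fun _ => q) ∧
      ContDiffOn ℝ ∞ W (spacetime U) ∧ ContDiffOn ℝ ∞ H (spacetime U) ∧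
      g = liftMetric dzForm (rescaledForm F) P W H ∧
      IsLorentzianOn g (spacetime U) ∧
      IsShearfreeOn g (spacetime U) partialR ∧
      IsEinsteinOn g (spacetime U) Λ ∧
      (∀ p ∈ spacetime U, frame3 F P H p ⬝ᵥ (ricci g p *ᵥ frame3 F P H p) = 0) ∧
      ∀ p ∈ spacetime U, IsPetrovII g p ∨ IsPetrovD g p := by
  have hΛ0 : Λ ≠ 0 := right_ne_zero_of_mul hΛ.ne'
  -- Equal signs of Λo and Λ make the radicand positive, so that q is real and nonzero and q² is the
  -- radicand for both signs.
  have hr : 0 < 3 * Λo / (4 * Λ) := by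
    have h1 : 3 * Λo / (4 * Λ) = 3 / 4 * (Λo * Λ) / Λ ^ 2 := by
      field_simp
    rw [h1]
    positivity
  have hqq : q ^ 2 = 3 * Λo / (4 * Λ) := by
    rcases hq with rfl | rfl
    · exact Real.sq_sqrt hr.le
    · rw [neg_sq, Real.sq_sqrt hr.le]
  have hq0 : q ≠ 0 := fun h0 => by
    rw [h0] at hqq
    norm_num at hqq
    exact hr.ne' (by rw [← hqq])
  have hqΛ : Λ * q ^ 2 = 3 * (Λo / 4) := by
    rw [hqq]
    field_simp
  have hE := isEinsteinOn_taubNUTLift hU hF hpos hq0 hKE hqΛ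
  refine ⟨solvesLogisticOn_const hU hF hpos hKE hqΛ, conformalFactor F fun _ => q, fun _ => 0,
    liftH F (Λo / 4), taubNUTLift F q (Λo / 4), rfl, contDiffOn_const,
    contDiffOn_liftH hU hF _, rfl, isLorentzianOn_taubNUTLift hU hF hpos hq0 _,
    isShearfreeOn_taubNUTLift hU hF hpos q _, hE, fun p hp => ?_, fun p hp =>
    Or.inr (isPetrovD_taubNUTLift hU hF hpos hq0 hqΛ hE hp)⟩
  have hT := one_add_tOf_sq_ne p
  have hg := taubNUTLift_apply hU hF hpos q (Λo / 4) hp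
  have c2 : liftCoframe F p 2 2 = 1 := rfl
  have c3 : liftCoframe F p 2 3 = 0 := rfl
  have s2 : (Pi.single 3 1 : Fin 4 → ℝ) 2 = 0 := by simp
  have s3 : (Pi.single 3 1 : Fin 4 → ℝ) 3 = 1 := by simp
  have d2 : Matrix.diagonal (![1, 1, 0, 0] : Fin 4 → ℝ) 2 = 0 := by
    rw [funext_iff, forall_fin_four]
    simp
  have d3 : Matrix.diagonal (![1, 1, 0, 0] : Fin 4 → ℝ) 3 = 0 := by
    rw [funext_iff, forall_fin_four]
    simp
  -- By the Einstein equation it remains to see that e₃ is null: μ(e₃) = 0, and dr + Hλ vanishes on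
  -- 2f ∂_u - H ∂_r. The scale 1/P plays no role and is abstracted below.
  rw [hE p hp, Matrix.smul_mulVec, dotProduct_smul]
  simp only [frame3, dotProduct, Matrix.mulVec, Fin.sum_univ_four, hg, Pi.smul_apply, c2, c3, s2,
    s3, d2, d3, Pi.zero_apply, smul_eq_mul, Matrix.cons_val, mul_zero, zero_mul, mul_one,
    add_zero, zero_add, liftH, profile]
  generalize 1 / conformalFactor F (fun _ => q) p = c
  field_simp
  ring
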